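/- Let $B_E,B_F$ be $C^*$-algebras, and let $E$ and $F$ be full right Hilbert modules over $B_E$ and $B_F$ ("full" means that the inner products span a dense subspace of the coefficient algebra). Write $\odot$ for algebraic tensor products over $\mathbb C$, $\mathcal L(E)$ for the $C^*$-algebra of adjointable operators on $E$, $\theta_{x,y}\in\mathcal L(E)$ for the operator $z\mapsto x\langle y,z\rangle$, and $A_E=\mathcal K(E)$ for the closed linear span of the operators $\theta_{x,y}$; similarly for $F$. A $C^*$-norm on a $*$-algebra is a submultiplicative norm with $\|a^*a\|=\|a\|^2$. A $C^*$-norm on $E\odot F$ is a norm $\gamma$ with $\gamma(\mu(x,y,z))\le\gamma(x)\gamma(y)\gamma(z)$ and $\gamma(\mu(x,x,x))=\gamma(x)^3$ for all $x,y,z\in E\odot F$, where $\mu$ is the ternary product, linear in the outer variables and conjugate linear in the middle one, with $\mu(e\odot f,e'\odot f',e''\odot f'')=e\langle e',e''\rangle\odot f\langle f',f''\rangle$. For a norm $\alpha$ on $X\odot Y$, write $X\otimes_\alpha Y$ for the completion. Let $\gamma$ be a $C^*$-norm on $E\odot F$. Then: 1. $E\otimes_\gamma F$ is a right Hilbert module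 in the canonical way: there are a $C^*$-norm $\gamma_B$ on $B_E\odot B_F$ and a right Hilbert $B_E\otimes_{\gamma_B}B_F$-module structure on the Banach space $E\otimes_\gamma F$ with $\langle e\odot f,e'\odot f'\rangle=\langle e,e'\rangle\odot\langle f,f'\rangle$ for $e,e'\in E$, $f,f'\in F$. Let $\mathcal L(E\otimes_\gamma F)$ be the $C^*$-algebra of adjointable operators on this Hilbert module. 2. There is a $C^*$-norm $\gamma_A$ on $A_E\odot A_F$ (the one denoted by $\gamma$ in $A_E\otimes_\gamma A_F$) that corresponds to $\gamma$, in the sense that $\gamma_A([x,x])=\gamma(x)^2$ for all $x\in E\odot F$, where $[\cdot,\cdot]$ is the $A_E\odot A_F$-valued sesquilinear form, linear in the first variable, with $[e\odot f,e'\odot f']=\theta_{e,e'}\odot\theta_{f,f'}$; and $\gamma_A$ extends to a $C^*$-norm $\hat\gamma$ on $\mathcal L(E)\odot\mathcal L(F)$. 3. For these norms there are isometric $*$-homomorphisms $$A_E\otimes_{\gamma_A}A_F\hookrightarrow\mathcal L(E)\otimes_{\hat\gamma}\mathcal L(F)\hookrightarrow\mathcal L(E\otimes_\gamma F),$$ the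 first of which extends the inclusion $A_E\odot A_F\subseteq\mathcal L(E)\odot\mathcal L(F)$, while the second sends $S\odot T$ to the operator with $e\odot f\mapsto Se\odot Tf$ for all $e\in E$, $f\in F$. -/

import Mathlib

open scoped TensorProduct

set_option linter.unusedSectionVars false

noncomputable section

namespace HilbertTensor

/-! ### Hilbert modules

Mathlib's `CStarModule A E` has `inner x (a • y) = a * inner x y`. A right Hilbert module over a
C⋆-algebra `B` is therefore a `CStarModule Bᵐᵒᵖ E`: the right action is `x · b = op b • x`, and
`inner x y = op ⟪x, y⟫`. The definitions below are written for a general coefficient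
algebra `A` in Mathlib's convention; they are used with `A = Bᵐᵒᵖ`. -/

section HilbertModule

variable (A : Type*) {E : Type*} [NonUnitalCStarAlgebra A] [PartialOrder A] [StarOrderedRing A]
  [SMul A E] [NormedAddCommGroup E] [NormedSpace ℂ E] [CStarModule A E]

variable (E) in
/-- A Hilbert module is full if the inner products span a dense subspace of the coefficients. -/
def IsFull : Prop :=
  Dense (Submodule.span ℂ {a : A | ∃ x y : E, inner A x y = a} : Set A)

lemma ext_inner {x y : E} (h : ∀ v : E, inner A v x = inner A v y) : x = y := by
  rw [← sub_eq_zero, ← CStarModule.inner_self (A := A), CStarModule.inner_sub_right, h, sub_self]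

lemma add_op_smul (a b : A) (x : E) : (a + b) • x = a • x + b • x :=
  ext_inner A fun v => by simp [add_mul]

lemma op_smul_add (a : A) (x y : E) : a • (x + y) = a • x + a • y :=
  ext_inner A fun v => by simp [mul_add]

lemma op_smul_smul (a : A) (c : ℂ) (x : E) : a • (c • x) = c • (a • x) :=
  ext_inner A fun v => by simp [mul_smul_comm]

lemma smul_op_smul (c : ℂ) (a : A) (x : E) : (c • a) • x = c • (a • x) :=
  ext_inner A fun v => by simp [smul_mul_assoc]

lemma mul_op_smul (a b : A) (x : E) : (a * b) • x = a • (b • x) :=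
  ext_inner A fun v => by simp [mul_assoc]

lemma norm_op_smul_le (a : A) (x : E) : ‖a • x‖ ≤ ‖a‖ * ‖x‖ := by
  have h : ‖a • x‖ ^ 2 ≤ (‖a‖ * ‖x‖) ^ 2 := by
    rw [CStarModule.norm_sq_eq A, CStarModule.inner_op_smul_right, CStarModule.inner_op_smul_left]
    calc ‖a * (inner A x x * star a)‖ ≤ ‖a‖ * (‖inner A x x‖ * ‖star a‖) :=
          (norm_mul_le _ _).trans (by gcongr; exact norm_mul_le _ _)
      _ = (‖a‖ * ‖x‖) ^ 2 := by
          rw [norm_star, ← CStarModule.norm_sq_eq A]; ring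
  exact le_of_sq_le_sq h (by positivity)

variable (E) in
/-- The ternary product `μ(x, y, z) = x · ⟪y, z⟫` of a right Hilbert module, linear in the outer
variables and conjugate linear in the middle one. -/
def ternary : E →ₗ[ℂ] E →ₗ⋆[ℂ] E →ₗ[ℂ] E where
  toFun x :=
    { toFun := fun y =>
        { toFun := fun z => (inner A y z : A) • x
          map_add' := fun z w => by rw [CStarModule.inner_add_right, add_op_smul]
          map_smul' := fun c z => by
            rw [CStarModule.inner_smul_right_complex, smul_op_smul]; rfl }
      map_add' := fun y w => by
        ext z; simp [add_op_smul]
      map_smul' := fun c y => by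
        ext z; simp [smul_op_smul] }
  map_add' x w := by ext y z; simp [op_smul_add]
  map_smul' c x := by ext y z; simp [op_smul_smul]

lemma ternary_apply (x y z : E) : ternary A E x y z = (inner A y z : A) • x := rfl

variable (E) in
/-- The algebra of adjointable operators, as a subalgebra of the bounded operators. -/
def adjointableSubalgebra : Subalgebra ℂ (E →L[ℂ] E) where
  carrier := {T | ∃ S : E → E, ∀ x y, inner A (T x) y = inner A x (S y)}
  mul_mem' := by
    rintro T T' ⟨S, hS⟩ ⟨S', hS'⟩
    exact ⟨S' ∘ S, fun x y => by simp [hS, hS']⟩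
  add_mem' := by
    rintro T T' ⟨S, hS⟩ ⟨S', hS'⟩
    exact ⟨fun y => S y + S' y, fun x y => by simp [hS, hS']⟩
  algebraMap_mem' c := by
    refine ⟨fun y => star c • y, fun x y => ?_⟩
    simp [Algebra.algebraMap_eq_smul_one]

variable (E) in
/-- The C⋆-algebra `𝓛(E)` of adjointable operators, with the operator norm. -/
def Adjointable : Type _ := adjointableSubalgebra A E

variable {A}

namespace Adjointable

/-- An adjointable operator as a bounded operator. -/
def toCLM (T : Adjointable A E) : E →L[ℂ] E := T.1

instance : NormedRing (Adjointable A E) := inferInstanceAs (NormedRing (adjointableSubalgebra A E))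

instance : NormedAlgebra ℂ (Adjointable A E) :=
  inferInstanceAs (NormedAlgebra ℂ (adjointableSubalgebra A E))

lemma toCLM_injective : Function.Injective (toCLM : Adjointable A E → E →L[ℂ] E) :=
  Subtype.val_injective

lemma exists_adjoint (T : Adjointable A E) :
    ∃ S : E →L[ℂ] E, ∀ x y, inner A (T.toCLM x) y = inner A x (S y) := by
  obtain ⟨T, S, hS⟩ := T
  let S' : E →ₗ[ℂ] E :=
    { toFun := S
      map_add' := fun x y => ext_inner A fun v => by simp [← hS]
      map_smul' := fun c x => ext_inner A fun v => by simp [← hS] }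
  refine ⟨S'.mkContinuous ‖T‖ fun x => ?_, hS⟩
  have h : ‖S x‖ ^ 2 ≤ (‖T‖ * ‖x‖) * ‖S x‖ := by
    rw [CStarModule.norm_sq_eq A, ← hS]
    calc _ ≤ ‖T (S x)‖ * ‖x‖ := CStarModule.norm_inner_le E
      _ ≤ (‖T‖ * ‖S x‖) * ‖x‖ := by gcongr; exact T.le_opNorm _
      _ = _ := by ring
  change ‖S x‖ ≤ _
  rcases (norm_nonneg (S x)).eq_or_lt with h0 | h0
  · rw [← h0]; positivity
  · rw [sq] at h; exact le_of_mul_le_mul_right h h0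

/-- The adjoint of an adjointable operator, as a bounded operator. -/
def adjointCLM (T : Adjointable A E) : E →L[ℂ] E := (exists_adjoint T).choose

lemma inner_adjointCLM_right (T : Adjointable A E) (x y : E) :
    inner A (T.toCLM x) y = inner A x (adjointCLM T y) := (exists_adjoint T).choose_spec x y

lemma inner_adjointCLM_left (T : Adjointable A E) (x y : E) :
    inner A (adjointCLM T x) y = inner A x (T.toCLM y) := by
  rw [← CStarModule.star_inner, ← inner_adjointCLM_right, CStarModule.star_inner]

/-- The involution of `𝓛(E)` is the adjoint. -/
instance : Star (Adjointable A E) where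
  star T := ⟨adjointCLM T, T.toCLM, inner_adjointCLM_left T⟩

lemma inner_star_right (T : Adjointable A E) (x y : E) :
    inner A x ((star T).toCLM y) = inner A (T.toCLM x) y := (inner_adjointCLM_right T x y).symm

lemma ext' {S T : Adjointable A E} (h : ∀ x, S.toCLM x = T.toCLM x) : S = T :=
  toCLM_injective (ContinuousLinearMap.ext h)

lemma star_eq_of_inner {S T : Adjointable A E}
    (h : ∀ x y, inner A (T.toCLM x) y = inner A x (S.toCLM y)) : star T = S :=
  ext' fun y => ext_inner A fun x => by rw [inner_star_right, h]

instance : StarRing (Adjointable A E) where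
  star_involutive T := star_eq_of_inner fun x y => by
    rw [← CStarModule.star_inner, inner_star_right, CStarModule.star_inner]
  star_mul S T := star_eq_of_inner fun x y => by
    change inner A (S.toCLM (T.toCLM x)) y = inner A x ((star T).toCLM ((star S).toCLM y))
    rw [inner_star_right, inner_star_right]
  star_add S T := star_eq_of_inner fun x y => by
    change inner A (S.toCLM x + T.toCLM x) y = inner A x ((star S).toCLM y + (star T).toCLM y)
    rw [CStarModule.inner_add_right, inner_star_right, inner_star_right, CStarModule.inner_add_left]

instance : StarModule ℂ (Adjointable A E) where
  star_smul c T := star_eq_of_inner fun x y => by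
    change inner A (c • T.toCLM x) y = inner A x (star c • (star T).toCLM y)
    rw [CStarModule.inner_smul_right_complex, inner_star_right,
      CStarModule.inner_smul_left_complex]

lemma norm_eq (T : Adjointable A E) : ‖T‖ = ‖T.toCLM‖ := rfl

lemma norm_apply_le (T : Adjointable A E) (x : E) : ‖T.toCLM x‖ ≤ ‖T‖ * ‖x‖ := T.toCLM.le_opNorm x

instance : CStarRing (Adjointable A E) where
  norm_mul_self_le T := by
    have key : ∀ x : E, ‖T.toCLM x‖ ≤ √‖star T * T‖ * ‖x‖ := fun x => by
      have h : ‖T.toCLM x‖ ^ 2 ≤ ‖star T * T‖ * ‖x‖ ^ 2 := by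
        rw [CStarModule.norm_sq_eq A, ← inner_star_right]
        calc _ ≤ ‖x‖ * ‖(star T * T).toCLM x‖ := CStarModule.norm_inner_le E
          _ ≤ ‖x‖ * (‖star T * T‖ * ‖x‖) := by gcongr; exact norm_apply_le _ x
          _ = _ := by ring
      refine le_of_sq_le_sq ?_ (by positivity)
      rwa [mul_pow, Real.sq_sqrt (norm_nonneg _)]
    have h1 : ‖T‖ ≤ √‖star T * T‖ := T.toCLM.opNorm_le_bound (Real.sqrt_nonneg _) key
    calc ‖T‖ * ‖T‖ ≤ √‖star T * T‖ * √‖star T * T‖ := by gcongr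
      _ = ‖star T * T‖ := Real.mul_self_sqrt (norm_nonneg _)

lemma isometry_toCLM : Isometry (toCLM : Adjointable A E → E →L[ℂ] E) :=
  Isometry.of_dist_eq fun _ _ => rfl

lemma toCLM_sub (S T : Adjointable A E) : (S - T).toCLM = S.toCLM - T.toCLM := rfl

instance [CompleteSpace E] : CompleteSpace (Adjointable A E) := by
  refine Metric.complete_of_cauchySeq_tendsto fun t ht => ?_
  have hs : CauchySeq fun n => star (t n) := by
    rw [Metric.cauchySeq_iff] at ht ⊢
    intro ε hε
    obtain ⟨N, hN⟩ := ht ε hε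
    refine ⟨N, fun m hm n hn => ?_⟩
    have h := hN m hm n hn
    rw [dist_eq_norm, ← norm_star, star_sub] at h
    rwa [dist_eq_norm]
  obtain ⟨T, hT⟩ := cauchySeq_tendsto_of_complete
    (isometry_toCLM.uniformContinuous.comp_cauchySeq ht)
  obtain ⟨S, hS⟩ := cauchySeq_tendsto_of_complete
    (isometry_toCLM.uniformContinuous.comp_cauchySeq hs)
  refine ⟨⟨T, S, fun x y => ?_⟩, ?_⟩
  · have hT' : Filter.Tendsto (fun n => (t n).toCLM x) Filter.atTop (nhds (T x)) :=
      ((ContinuousLinearMap.apply ℂ E x).continuous.tendsto T).comp hT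
    have hS' : Filter.Tendsto (fun n => (star (t n)).toCLM y) Filter.atTop (nhds (S y)) :=
      ((ContinuousLinearMap.apply ℂ E y).continuous.tendsto S).comp hS
    have hi : Continuous fun p : E × E => inner A p.1 p.2 := CStarModule.continuous_inner
    have h1 := (hi.tendsto (T x, y)).comp (hT'.prodMk_nhds tendsto_const_nhds)
    have h2 := (hi.tendsto (x, S y)).comp (tendsto_const_nhds.prodMk_nhds hS')
    exact tendsto_nhds_unique h1 (h2.congr fun n => inner_star_right (t n) x y)
  · exact isometry_toCLM.isEmbedding.tendsto_nhds_iff.2 hT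

instance [CompleteSpace E] : CStarAlgebra (Adjointable A E) where

end Adjointable

open Adjointable

variable (A) in
/-- The operator `θ_{x, y} : z ↦ x · ⟪y, z⟫`, as an element of `𝓛(E)`. -/
def theta (x y : E) : Adjointable A E :=
  ⟨(ternary A E x y).mkContinuous (‖x‖ * ‖y‖) fun z => by
      rw [ternary_apply]
      calc _ ≤ ‖inner A y z‖ * ‖x‖ := norm_op_smul_le A _ _
        _ ≤ (‖y‖ * ‖z‖) * ‖x‖ := by gcongr; exact CStarModule.norm_inner_le E
        _ = _ := by ring,
    ternary A E y x, fun z w => by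
      change inner A ((inner A y z : A) • x) w = inner A z ((inner A x w : A) • y)
      simp⟩

lemma theta_apply (x y z : E) : (theta A x y).toCLM z = (inner A y z : A) • x := rfl

lemma star_theta (x y : E) : star (theta A x y) = theta A y x :=
  star_eq_of_inner fun z w => by simp [theta_apply]

lemma toCLM_op_smul (T : Adjointable A E) (a : A) (x : E) : T.toCLM (a • x) = a • T.toCLM x :=
  ext_inner A fun v => by
    rw [CStarModule.inner_op_smul_right, ← star_star T, inner_star_right, inner_star_right,
      CStarModule.inner_op_smul_right]

lemma mul_theta (T : Adjointable A E) (x y : E) : T * theta A x y = theta A (T.toCLM x) y :=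
  ext' fun _ => toCLM_op_smul T _ _

variable (A E) in
/-- The linear span of the operators `θ_{x, y}`, a `*`-subalgebra of `𝓛(E)`. -/
def finiteRank : NonUnitalStarSubalgebra ℂ (Adjointable A E) where
  __ := Submodule.span ℂ {T | ∃ x y : E, theta A x y = T}
  mul_mem' := by
    intro S T hS hT
    simp only [AddSubsemigroup.mem_carrier, AddSubmonoid.mem_toSubsemigroup,
      Submodule.mem_toAddSubmonoid] at hT ⊢
    induction hT using Submodule.span_induction with
    | mem T h =>
      obtain ⟨x, y, rfl⟩ := h
      rw [mul_theta]
      exact Submodule.subset_span ⟨_, _, rfl⟩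
    | zero => rw [mul_zero]; exact Submodule.zero_mem _
    | add T T' _ _ h h' => rw [mul_add]; exact Submodule.add_mem _ h h'
    | smul c T _ h => rw [mul_smul_comm]; exact Submodule.smul_mem _ _ h
  star_mem' := by
    intro T hT
    simp only [AddSubsemigroup.mem_carrier, AddSubmonoid.mem_toSubsemigroup,
      Submodule.mem_toAddSubmonoid] at hT ⊢
    induction hT using Submodule.span_induction with
    | mem T h =>
      obtain ⟨x, y, rfl⟩ := h
      rw [star_theta]
      exact Submodule.subset_span ⟨_, _, rfl⟩
    | zero => rw [star_zero]; exact Submodule.zero_mem _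
    | add T T' _ _ h h' => rw [star_add]; exact Submodule.add_mem _ h h'
    | smul c T _ h => rw [star_smul]; exact Submodule.smul_mem _ _ h

variable (A E) in
/-- The algebra `𝓚(E)` of compact operators, the closed linear span of the `θ_{x, y}`. It is the
C⋆-algebra `A_E` for which `E` is a full left Hilbert module, with inner product
`(x, y) ↦ θ_{x, y}`. -/
def compacts : NonUnitalStarSubalgebra ℂ (Adjointable A E) := (finiteRank A E).topologicalClosure

lemma theta_mem_compacts (x y : E) : theta A x y ∈ compacts A E :=
  subset_closure (Submodule.subset_span ⟨x, y, rfl⟩)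

variable (A E) in
/-- The left inner product `(x, y) ↦ θ_{x, y}` with values in `𝓚(E)`. -/
def leftInner : E →ₗ[ℂ] E →ₗ⋆[ℂ] compacts A E where
  toFun x :=
    { toFun := fun y => ⟨theta A x y, theta_mem_compacts x y⟩
      map_add' := fun y w => Subtype.ext <| ext' fun z =>
        congrArg (fun f => f z) ((ternary A E x).map_add y w)
      map_smul' := fun c y => Subtype.ext <| ext' fun z =>
        congrArg (fun f => f z) ((ternary A E x).map_smulₛₗ c y) }
  map_add' x w := by
    ext y : 1
    exact Subtype.ext <| ext' fun z =>
      congrArg (fun f => f y z) ((ternary A E).map_add x w)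
  map_smul' c x := by
    ext y : 1
    exact Subtype.ext <| ext' fun z =>
      congrArg (fun f => f y z) ((ternary A E).map_smul c x)

end HilbertModule

/-! ### C⋆-norms on `*`-algebras and their completions -/

section Algebra

/-- The involution of the tensor product of two (possibly non-unital) `*`-algebras. -/
instance tensorStarRing {R S : Type*} [NonUnitalRing R] [StarRing R] [Module ℂ R]
    [IsScalarTower ℂ R R] [SMulCommClass ℂ R R] [StarModule ℂ R] [NonUnitalRing S] [StarRing S]
    [Module ℂ S] [IsScalarTower ℂ S S] [SMulCommClass ℂ S S] [StarModule ℂ S] :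
    StarRing (R ⊗[ℂ] S) where
  star_mul x y := by
    induction x with
    | zero => simp
    | add _ _ h h' => simp [add_mul, mul_add, h, h']
    | tmul _ _ =>
      induction y with
      | zero => simp
      | add _ _ h h' => simp [add_mul, mul_add, h, h']
      | tmul _ _ => simp
  star_add := by simp

section Extend

variable {V W : Type*} [NormedAddCommGroup V] [NormedSpace ℂ V] [NormedAddCommGroup W]
  [NormedSpace ℂ W] [CompleteSpace W]

/-- The extension of a bounded bilinear map `V × V → W` along a dense isometry `V → W`. -/
def extend₂ (e : V →ₗᵢ[ℂ] W) (f : V →L[ℂ] V →L[ℂ] W) : W →L[ℂ] W →L[ℂ] W :=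
  ((f.extend e.toContinuousLinearMap).flip.extend e.toContinuousLinearMap).flip

lemma extend₂_apply {e : V →ₗᵢ[ℂ] W} (he : DenseRange e) (f : V →L[ℂ] V →L[ℂ] W) (x y : V) :
    extend₂ e f (e x) (e y) = f x y := by
  have h1 : f.extend e.toContinuousLinearMap (e x) = f x :=
    ContinuousLinearMap.extend_eq f (e := e.toContinuousLinearMap) he e.isometry.isUniformInducing x
  have h2 : (f.extend e.toContinuousLinearMap).flip.extend e.toContinuousLinearMap (e y) =
      (f.extend e.toContinuousLinearMap).flip y :=
    ContinuousLinearMap.extend_eq _ (e := e.toContinuousLinearMap) he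
      e.isometry.isUniformInducing y
  rw [extend₂, ContinuousLinearMap.flip_apply, h2, ContinuousLinearMap.flip_apply, h1]

end Extend

/-- A C⋆-norm on a complex `*`-algebra. -/
structure CStarNorm (R : Type*) [NonUnitalRing R] [StarRing R] [Module ℂ R] extends
    Seminorm ℂ R where
  eq_zero_of_map_eq_zero' : ∀ x, toFun x = 0 → x = 0
  map_mul_le' : ∀ x y, toFun (x * y) ≤ toFun x * toFun y
  map_star_mul_self' : ∀ x, toFun (star x * x) = toFun x ^ 2

variable {R : Type*} [NonUnitalRing R] [StarRing R] [Module ℂ R]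

instance : CoeFun (CStarNorm R) fun _ => R → ℝ := ⟨fun p => p.toFun⟩

namespace CStarNorm

/-- The `*`-algebra `R`, normed by the C⋆-norm `p`. -/
@[nolint unusedArguments]
def Normed (_p : CStarNorm R) : Type _ := R

variable (p : CStarNorm R)

instance : NonUnitalRing p.Normed := inferInstanceAs (NonUnitalRing R)
instance : StarRing p.Normed := inferInstanceAs (StarRing R)
instance : Module ℂ p.Normed := inferInstanceAs (Module ℂ R)
instance [h : IsScalarTower ℂ R R] : IsScalarTower ℂ p.Normed p.Normed := h
instance [h : SMulCommClass ℂ R R] : SMulCommClass ℂ p.Normed p.Normed := h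
instance [h : StarModule ℂ R] : StarModule ℂ p.Normed := h

instance : NormedAddCommGroup p.Normed :=
  AddGroupNorm.toNormedAddCommGroup
    { toFun := p
      map_zero' := p.map_zero'
      add_le' := p.add_le'
      neg' := p.neg'
      eq_zero_of_map_eq_zero' := p.eq_zero_of_map_eq_zero' }

lemma norm_def (x : p.Normed) : ‖x‖ = p x := rfl

instance : NormedSpace ℂ p.Normed where
  norm_smul_le c x := (p.smul' c x).le

lemma norm_mul_le' (x y : p.Normed) : ‖x * y‖ ≤ ‖x‖ * ‖y‖ := p.map_mul_le' x y

lemma norm_star_mul_self' (x : p.Normed) : ‖star x * x‖ = ‖x‖ ^ 2 := p.map_star_mul_self' x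

lemma norm_star_le (x : p.Normed) : ‖x‖ ≤ ‖star x‖ := by
  have h := (p.norm_star_mul_self' x).symm.trans_le (p.norm_mul_le' _ _)
  rcases (norm_nonneg x).eq_or_lt with h0 | h0
  · rw [← h0]; positivity
  · rw [sq] at h; exact le_of_mul_le_mul_right h h0

lemma norm_star' (x : p.Normed) : ‖star x‖ = ‖x‖ :=
  le_antisymm (by simpa using p.norm_star_le (star x)) (p.norm_star_le x)

/-- The completion of the `*`-algebra `R` in the C⋆-norm `p`. -/
def Completion : Type _ := UniformSpace.Completion p.Normed

/-- The canonical map from `R` to its completion. -/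
def emb (x : R) : p.Completion := ((show p.Normed from x : p.Normed) : UniformSpace.Completion p.Normed)

instance : NormedAddCommGroup p.Completion :=
  inferInstanceAs (NormedAddCommGroup (UniformSpace.Completion p.Normed))

instance : NormedSpace ℂ p.Completion :=
  inferInstanceAs (NormedSpace ℂ (UniformSpace.Completion p.Normed))

instance : CompleteSpace p.Completion :=
  inferInstanceAs (CompleteSpace (UniformSpace.Completion p.Normed))

/-- The canonical map from `R` to its completion, as a linear isometry. -/
def mkₗᵢ : p.Normed →ₗᵢ[ℂ] p.Completion := UniformSpace.Completion.toComplₗᵢ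

lemma denseRange_mkₗᵢ : DenseRange p.mkₗᵢ := UniformSpace.Completion.denseRange_coe

lemma isUniformInducing_mkₗᵢ : IsUniformInducing p.mkₗᵢ := p.mkₗᵢ.isometry.isUniformInducing

variable [IsScalarTower ℂ R R] [SMulCommClass ℂ R R]

/-- Multiplication as a bounded bilinear map into the completion. -/
def mulL : p.Normed →L[ℂ] p.Normed →L[ℂ] p.Completion :=
  LinearMap.mkContinuous₂ ((LinearMap.mul ℂ p.Normed).compr₂ p.mkₗᵢ.toLinearMap) 1 fun x y => by
    simpa using p.norm_mul_le' x y

lemma mulL_apply (x y : p.Normed) : p.mulL x y = p.mkₗᵢ (x * y) := rfl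

/-- Multiplication on the completion, as a bounded bilinear map. -/
def mulC : p.Completion →L[ℂ] p.Completion →L[ℂ] p.Completion :=
  extend₂ p.mkₗᵢ p.mulL

lemma mulC_mk (x y : p.Normed) : p.mulC (p.mkₗᵢ x) (p.mkₗᵢ y) = p.mkₗᵢ (x * y) :=
  extend₂_apply p.denseRange_mkₗᵢ p.mulL x y

instance : Mul p.Completion := ⟨fun x y => p.mulC x y⟩

lemma mkₗᵢ_mul (x y : p.Normed) : p.mkₗᵢ x * p.mkₗᵢ y = p.mkₗᵢ (x * y) := p.mulC_mk x y

@[fun_prop]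
lemma continuous_mul' {X : Type*} [TopologicalSpace X] {f g : X → p.Completion}
    (hf : Continuous f) (hg : Continuous g) : Continuous fun x => f x * g x :=
  (p.mulC.continuous.comp hf).clm_apply hg

instance : NonUnitalNormedRing p.Completion where
  __ := (inferInstance : NormedAddCommGroup p.Completion)
  left_distrib x y z := (p.mulC x).map_add y z
  right_distrib x y z := p.mulC.map_add₂ x y z
  zero_mul x := p.mulC.map_zero₂ x
  mul_zero x := (p.mulC x).map_zero
  mul_assoc x y z := by
    induction x, y, z using p.denseRange_mkₗᵢ.induction_on₃ with
    | hp => exact isClosed_eq (by fun_prop) (by fun_prop)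
    | h x y z => simp only [mkₗᵢ_mul, mul_assoc]
  norm_mul_le x y := by
    induction x, y using p.denseRange_mkₗᵢ.induction_on₂ with
    | hp => exact isClosed_le (by fun_prop) (by fun_prop)
    | h x y => simpa only [mkₗᵢ_mul, LinearIsometry.norm_map] using p.norm_mul_le' x y

variable [StarModule ℂ R]

/-- The involution as a conjugate linear isometry into the completion. -/
def starL : p.Normed →L⋆[ℂ] p.Completion :=
  LinearMap.mkContinuous
    { toFun := fun x => p.mkₗᵢ (star x)
      map_add' := fun x y => by rw [star_add, map_add]
      map_smul' := fun c x => by rw [star_smul, map_smul]; rfl } 1 fun x => by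
    rw [one_mul]; exact ((p.mkₗᵢ.norm_map _).trans (p.norm_star' x)).le

/-- The involution of the completion. -/
def starC : p.Completion →L⋆[ℂ] p.Completion :=
  p.starL.extend p.mkₗᵢ.toContinuousLinearMap

instance : Star p.Completion := ⟨fun x => p.starC x⟩

lemma mkₗᵢ_star (x : p.Normed) : star (p.mkₗᵢ x) = p.mkₗᵢ (star x) :=
  ContinuousLinearMap.extend_eq p.starL (e := p.mkₗᵢ.toContinuousLinearMap)
    p.denseRange_mkₗᵢ p.isUniformInducing_mkₗᵢ x

@[fun_prop]
lemma continuous_star' {X : Type*} [TopologicalSpace X] {f : X → p.Completion}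
    (hf : Continuous f) : Continuous fun x => star (f x) := p.starC.continuous.comp hf

instance : StarRing p.Completion where
  star_involutive x := by
    induction x using p.denseRange_mkₗᵢ.induction_on with
    | hp => exact isClosed_eq (by fun_prop) (by fun_prop)
    | ih x => simp only [mkₗᵢ_star, star_star]
  star_mul x y := by
    induction x, y using p.denseRange_mkₗᵢ.induction_on₂ with
    | hp => exact isClosed_eq (by fun_prop) (by fun_prop)
    | h x y => simp only [mkₗᵢ_mul, mkₗᵢ_star, star_mul]
  star_add x y := p.starC.map_add x y

/-- The completion of a `*`-algebra in a C⋆-norm is a C⋆-algebra. -/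
instance : NonUnitalCStarAlgebra p.Completion where
  smul_assoc c x y := p.mulC.map_smul₂ c x y
  smul_comm c x y := ((p.mulC x).map_smul c y).symm
  star_smul c x := p.starC.map_smulₛₗ c x
  norm_mul_self_le x := by
    induction x using p.denseRange_mkₗᵢ.induction_on with
    | hp => exact isClosed_le (by fun_prop) (by fun_prop)
    | ih x =>
      simp only [mkₗᵢ_mul, mkₗᵢ_star, LinearIsometry.norm_map, p.norm_star_mul_self', sq, le_refl]

/-- The order of the C⋆-algebra `p.Completion`. -/
instance : PartialOrder p.Completion := CStarAlgebra.spectralOrder _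

instance : StarOrderedRing p.Completion := CStarAlgebra.spectralOrderedRing _

end CStarNorm

end Algebra

/-! ### C⋆-norms on the tensor product of two Hilbert modules -/

section Ternary

variable (A B E F : Type*)
  [NonUnitalCStarAlgebra A] [PartialOrder A] [StarOrderedRing A]
  [NonUnitalCStarAlgebra B] [PartialOrder B] [StarOrderedRing B]
  [SMul A E] [NormedAddCommGroup E] [NormedSpace ℂ E] [CStarModule A E]
  [SMul B F] [NormedAddCommGroup F] [NormedSpace ℂ F] [CStarModule B F]

/-- The ternary product `μ ⊙ ν` of the algebraic tensor product `E ⊙ F`, determined by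
`(e ⊙ f, e' ⊙ f', e'' ⊙ f'') ↦ μ(e, e', e'') ⊙ ν(f, f', f'')`. -/
def tensorTernary (x y z : E ⊗[ℂ] F) : E ⊗[ℂ] F :=
  TensorProduct.homTensorHomMap (RingHom.id ℂ) E F E F
    (TensorProduct.map₂ (ternary A E) (ternary B F) x y) z

lemma tensorTernary_tmul (e e' e'' : E) (f f' f'' : F) :
    tensorTernary A B E F (e ⊗ₜ f) (e' ⊗ₜ f') (e'' ⊗ₜ f'') =
      ternary A E e e' e'' ⊗ₜ ternary B F f f' f'' := rfl

/-- The left inner product of `E ⊙ F` with values in `𝓚(E) ⊙ 𝓚(F)`, determined by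
`(e ⊙ f, e' ⊙ f') ↦ θ_{e, e'} ⊙ θ_{f, f'}`. -/
def tensorLeftInner :
    E ⊗[ℂ] F →ₗ[ℂ] E ⊗[ℂ] F →ₗ⋆[ℂ] compacts A E ⊗[ℂ] compacts B F :=
  TensorProduct.map₂ (leftInner A E) (leftInner B F)

/-- The inclusion `𝓚(E) ⊙ 𝓚(F) → 𝓛(E) ⊙ 𝓛(F)`. -/
def compactsIncl :
    compacts A E ⊗[ℂ] compacts B F →ₗ[ℂ] Adjointable A E ⊗[ℂ] Adjointable B F :=
  TensorProduct.map (compacts A E).toSubmodule.subtype (compacts B F).toSubmodule.subtype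

/-- A C⋆-norm on the `*`-ternary ring `(E ⊙ F, μ ⊙ ν)`. -/
structure TernaryCStarNorm extends Seminorm ℂ (E ⊗[ℂ] F) where
  eq_zero_of_map_eq_zero' : ∀ x, toFun x = 0 → x = 0
  map_ternary_le' : ∀ x y z,
    toFun (tensorTernary A B E F x y z) ≤ toFun x * toFun y * toFun z
  map_ternary_self' : ∀ x, toFun (tensorTernary A B E F x x x) = toFun x ^ 3

variable {A B E F}

instance : CoeFun (TernaryCStarNorm A B E F) fun _ => E ⊗[ℂ] F → ℝ := ⟨fun γ => γ.toFun⟩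

namespace TernaryCStarNorm

/-- The space `E ⊙ F`, normed by `γ`. -/
@[nolint unusedArguments]
def Normed (_γ : TernaryCStarNorm A B E F) : Type _ := E ⊗[ℂ] F

variable (γ : TernaryCStarNorm A B E F)

instance : AddCommGroup γ.Normed := inferInstanceAs (AddCommGroup (E ⊗[ℂ] F))
instance : Module ℂ γ.Normed := inferInstanceAs (Module ℂ (E ⊗[ℂ] F))

instance : NormedAddCommGroup γ.Normed :=
  AddGroupNorm.toNormedAddCommGroup
    { toFun := γ
      map_zero' := γ.map_zero'
      add_le' := γ.add_le'
      neg' := γ.neg'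
      eq_zero_of_map_eq_zero' := γ.eq_zero_of_map_eq_zero' }

instance : NormedSpace ℂ γ.Normed where
  norm_smul_le c x := (γ.smul' c x).le

/-- The tensor product `E ⊗_γ F`, the completion of `E ⊙ F` in the norm `γ`. -/
abbrev Completion : Type _ := UniformSpace.Completion γ.Normed

/-- The canonical map from `E ⊙ F` to `E ⊗_γ F`. -/
def emb (x : E ⊗[ℂ] F) : γ.Completion := ((show γ.Normed from x : γ.Normed) : γ.Completion)

lemma norm_emb (x : E ⊗[ℂ] F) : ‖γ.emb x‖ = γ x := UniformSpace.Completion.norm_coe _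

end TernaryCStarNorm

end Ternary

end HilbertTensor

end

/-! Everything is read off from the action of operators on `E ⊙ F` and from the way they move
between the slots of `μ`. If `T` is an operator with adjoint `T'`, then `μ x (T y) z = μ x y (T'
z)`. If moreover `T' T = 1`, then `γ(Tx)³ = γ(μ(Tx, Tx, Tx)) = γ(μ(Tx, x, x)) ≤ γ(Tx) γ(x)²`, so
`γ(Tx) ≤ γ(x)` (`le_of_ternary_mid`). This applies to `u ⊙ v` for unitaries `u`, `v`, and unitaries
span a unital C⋆-algebra. Hence all of `𝓛(E) ⊙ 𝓛(F)` acts by bounded operators, and so does `B_E ⊙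
B_F` from the right, through the unitizations.

The norms `γ̂`, `γ_A` and `γ_B` are the operator norms of these actions on `E ⊗_γ F`. They are norms
because a tensor product of injective families of operators is injective (`tensorOp_injective`); on
the right, injectivity is where fullness is needed. The same cubic computation with `T = t` gives
`γ(tx)³ ≤ ‖t‖ ‖t* t‖ γ(x)³`, hence `‖t‖² ≤ ‖t* t‖`, the C⋆-identity. Since `[x, x]` acts as `z ↦
μ(x, x, z)` and `⟨x, x⟩` as `z ↦ μ(z, x, x)`, both have norm `γ(x)²`. With these norms the two
embeddings are isometric by construction.

What remains is the positivity of `⟨x, x⟩`. The axioms for `γ` do not see the sign of `μ`, so it has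
to come from `E` and `F`. By functional calculus finitely many vectors are almost fixed by some `∑
θ_{u, u}` (`exists_sum_theta_approx`). Thus `⟨x, x⟩` is a limit of `⟨x, (k ⊙ l) x⟩` with `k`, `l` of
this form, and these are sums of elements `b* b`. The limit is legitimate because `γ(e ⊙ f) ≤ ‖e‖
‖f‖` (`apply_tmul_le`). -/

noncomputable section

namespace HilbertTensor

/-! ### Operators on tensor products of vector spaces -/

section TensorOperators

variable {V W M N P Q : Type*} [AddCommGroup V] [Module ℂ V] [AddCommGroup W] [Module ℂ W]
  [AddCommGroup M] [Module ℂ M] [AddCommGroup N] [Module ℂ N]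
  [AddCommGroup P] [Module ℂ P] [AddCommGroup Q] [Module ℂ Q]

/-- The family of operators `f v ⊙ g w` attached to two families of operators. -/
def tensorOp (f : V →ₗ[ℂ] M →ₗ[ℂ] P) (g : W →ₗ[ℂ] N →ₗ[ℂ] Q) :
    V ⊗[ℂ] W →ₗ[ℂ] M ⊗[ℂ] N →ₗ[ℂ] P ⊗[ℂ] Q := TensorProduct.map₂ f g

lemma tensorOp_tmul (f : V →ₗ[ℂ] M →ₗ[ℂ] P) (g : W →ₗ[ℂ] N →ₗ[ℂ] Q) (v : V) (w : W) (m : M)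
    (n : N) : tensorOp f g (v ⊗ₜ w) (m ⊗ₜ n) = f v m ⊗ₜ g w n := rfl

/-- Expand `t` in a basis of `W`, with coefficients in `V`. Evaluating at `m` applies `f · m` to
each coefficient, so every coefficient lies in the kernel of `f`. -/
lemma eq_zero_of_forall_rTensor {f : V →ₗ[ℂ] M →ₗ[ℂ] P} (hf : Function.Injective f)
    {t : V ⊗[ℂ] W} (h : ∀ m, (f.flip m).rTensor W t = 0) : t = 0 := by
  classical
  let b := Module.Basis.ofVectorSpace ℂ W
  have key : ∀ (m : M) (s : V ⊗[ℂ] W) i,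
      TensorProduct.equivFinsuppOfBasisRight b ((f.flip m).rTensor W s) i =
        f (TensorProduct.equivFinsuppOfBasisRight b s i) m := by
    intro m s i
    induction s with
    | zero => simp
    | add _ _ h h' => simp [h, h']
    | tmul v w => simp
  rw [← (TensorProduct.equivFinsuppOfBasisRight b).map_eq_zero_iff]
  ext i
  apply hf
  ext m
  rw [← key, h]
  simp

lemma eq_zero_of_forall_lTensor {g : W →ₗ[ℂ] N →ₗ[ℂ] Q} (hg : Function.Injective g)
    {t : V ⊗[ℂ] W} (h : ∀ n, (g.flip n).lTensor V t = 0) : t = 0 := by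
  rw [← (TensorProduct.comm ℂ V W).map_eq_zero_iff]
  refine eq_zero_of_forall_rTensor hg fun n => ?_
  rw [← (TensorProduct.comm ℂ Q V).map_eq_zero_iff, ← h n]
  exact (TensorProduct.map_comm _ _ _).symm.trans (by simp [LinearMap.lTensor])

/-- This is why the operator norms on the algebraic tensor products are definite. Evaluation at `m
⊗ₜ n` is done one leg at a time, and each leg is handled by slicing. -/
lemma tensorOp_injective {f : V →ₗ[ℂ] M →ₗ[ℂ] P} (hf : Function.Injective f)
    {g : W →ₗ[ℂ] N →ₗ[ℂ] Q} (hg : Function.Injective g) : Function.Injective (tensorOp f g) := by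
  rw [injective_iff_map_eq_zero]
  intro t ht
  refine eq_zero_of_forall_rTensor hf fun m => eq_zero_of_forall_lTensor hg fun n => ?_
  have key : ∀ s : V ⊗[ℂ] W,
      (g.flip n).lTensor P ((f.flip m).rTensor W s) = tensorOp f g s (m ⊗ₜ n) := by
    intro s
    induction s with
    | zero => simp
    | add _ _ h h' => simp [h, h']
    | tmul v w => simp [tensorOp_tmul]
  rw [key, ht, LinearMap.zero_apply]

end TensorOperators

/-! ### Multiplicativity and `*`-compatibility of tensor products of maps. -/

section TensorMap

variable {R S R' S' : Type*}
  [NonUnitalRing R] [StarRing R] [Module ℂ R] [StarModule ℂ R]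
  [IsScalarTower ℂ R R] [SMulCommClass ℂ R R]
  [NonUnitalRing S] [StarRing S] [Module ℂ S] [StarModule ℂ S]
  [IsScalarTower ℂ S S] [SMulCommClass ℂ S S]
  [NonUnitalRing R'] [StarRing R'] [Module ℂ R'] [StarModule ℂ R']
  [IsScalarTower ℂ R' R'] [SMulCommClass ℂ R' R']
  [NonUnitalRing S'] [StarRing S'] [Module ℂ S'] [StarModule ℂ S']
  [IsScalarTower ℂ S' S'] [SMulCommClass ℂ S' S']
  {f : R →ₗ[ℂ] R'} {g : S →ₗ[ℂ] S'}

lemma tensorMap_mul (hf : ∀ a b, f (a * b) = f a * f b) (hg : ∀ a b, g (a * b) = g a * g b)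
    (s t : R ⊗[ℂ] S) :
    TensorProduct.map f g (s * t) = TensorProduct.map f g s * TensorProduct.map f g t := by
  induction s with
  | zero => simp
  | add _ _ h h' => simp [add_mul, h, h']
  | tmul a b =>
    induction t with
    | zero => simp
    | add _ _ h h' => simp only [mul_add, map_add, h, h']
    | tmul a' b' => simp [hf, hg]

lemma tensorMap_star (hf : ∀ a, f (star a) = star (f a)) (hg : ∀ a, g (star a) = star (g a))
    (t : R ⊗[ℂ] S) : TensorProduct.map f g (star t) = star (TensorProduct.map f g t) := by
  induction t with
  | zero => simp
  | add _ _ h h' => simp only [star_add, map_add, h, h']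
  | tmul a b => simp [hf, hg]

end TensorMap


/-! ### Constructions with C⋆-norms -/

namespace CStarNorm

section Construct

variable {R : Type*} [NonUnitalRing R] [StarRing R] [Module ℂ R]

/-- The C⋆-norm induced by an injective linear map into a normed space. -/
def induced {V : Type*} [NormedAddCommGroup V] [NormedSpace ℂ V] (φ : R →ₗ[ℂ] V)
    (hφ : Function.Injective φ) (hmul : ∀ a b, ‖φ (a * b)‖ ≤ ‖φ a‖ * ‖φ b‖)
    (hstar : ∀ a, ‖φ a‖ * ‖φ a‖ ≤ ‖φ (star a * a)‖) : CStarNorm R where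
  __ := (normSeminorm ℂ V).comp φ
  eq_zero_of_map_eq_zero' x hx := hφ (by
    rw [map_zero]; exact norm_eq_zero.1 hx)
  map_mul_le' := hmul
  map_star_mul_self' x := by
    change ‖φ (star x * x)‖ = ‖φ x‖ ^ 2
    -- Cancel one factor in `‖φ a‖² ≤ ‖φ (a* a)‖ ≤ ‖φ a*‖ ‖φ a‖`. Used for `a = x*`, this turns the
    -- one-sided hypothesis `hstar` into the C⋆-identity.
    have hle : ∀ a, ‖φ a‖ ≤ ‖φ (star a)‖ := fun a => by
      have h := (hstar a).trans (hmul _ _)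
      rcases (norm_nonneg (φ a)).eq_or_lt with h0 | h0
      · rw [← h0]; positivity
      · exact le_of_mul_le_mul_right h h0
    refine le_antisymm ?_ (by rw [sq]; exact hstar x)
    rw [sq]
    refine (hmul _ _).trans (by gcongr; simpa using hle (star x))

variable (p : CStarNorm R)

lemma norm_emb (x : R) : ‖p.emb x‖ = p x := UniformSpace.Completion.norm_coe _

lemma denseRange_emb : DenseRange p.emb := p.denseRange_mkₗᵢ

lemma emb_add (x y : R) : p.emb (x + y) = p.emb x + p.emb y := p.mkₗᵢ.map_add x y

lemma emb_smul (c : ℂ) (x : R) : p.emb (c • x) = c • p.emb x := p.mkₗᵢ.map_smul c x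

lemma emb_sum {ι : Type*} (s : Finset ι) (a : ι → R) :
    p.emb (∑ i ∈ s, a i) = ∑ i ∈ s, p.emb (a i) := map_sum p.mkₗᵢ _ _

lemma emb_zero : p.emb 0 = 0 := p.mkₗᵢ.map_zero

variable [IsScalarTower ℂ R R] [SMulCommClass ℂ R R]

lemma emb_mul (x y : R) : p.emb (x * y) = p.emb x * p.emb y := (p.mkₗᵢ_mul x y).symm

variable [StarModule ℂ R]

lemma emb_star (x : R) : p.emb (star x) = star (p.emb x) := (p.mkₗᵢ_star x).symm

section Lift

variable {C : Type*} [NormedAddCommGroup C] [NormedSpace ℂ C] [CompleteSpace C]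

/-- The extension to the completion of a linear map that is isometric for a C⋆-norm. -/
def liftL (φ : R →ₗ[ℂ] C) (h : ∀ x, ‖φ x‖ = p x) : p.Completion →L[ℂ] C :=
  ((show p.Normed →ₗ[ℂ] C from φ).mkContinuous 1 fun x => by
    rw [one_mul]; exact (h x).le).extend p.mkₗᵢ.toContinuousLinearMap

lemma liftL_emb (φ : R →ₗ[ℂ] C) (h : ∀ x, ‖φ x‖ = p x) (x : R) : p.liftL φ h (p.emb x) = φ x :=
  ContinuousLinearMap.extend_eq _ (e := p.mkₗᵢ.toContinuousLinearMap)
    p.denseRange_mkₗᵢ p.isUniformInducing_mkₗᵢ x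

lemma norm_liftL (φ : R →ₗ[ℂ] C) (h : ∀ x, ‖φ x‖ = p x) (x : p.Completion) :
    ‖p.liftL φ h x‖ = ‖x‖ := by
  induction x using p.denseRange_emb.induction_on with
  | hp => exact isClosed_eq (by fun_prop) (by fun_prop)
  | ih x => rw [liftL_emb, h, norm_emb]

end Lift

/-- The extension to the completion of a `*`-homomorphism that is isometric for a C⋆-norm. -/
def lift {C : Type*} [NonUnitalCStarAlgebra C] (φ : R →ₗ[ℂ] C) (h : ∀ x, ‖φ x‖ = p x)
    (hmul : ∀ x y, φ (x * y) = φ x * φ y) (hstar : ∀ x, φ (star x) = star (φ x)) :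
    p.Completion →⋆ₙₐ[ℂ] C where
  __ := p.liftL φ h
  map_zero' := map_zero (p.liftL φ h)
  map_mul' x y := by
    change p.liftL φ h (x * y) = p.liftL φ h x * p.liftL φ h y
    induction x, y using p.denseRange_emb.induction_on₂ with
    | hp => exact isClosed_eq (by fun_prop) (by fun_prop)
    | h x y => rw [← emb_mul, liftL_emb, liftL_emb, liftL_emb, hmul]
  map_star' x := by
    change p.liftL φ h (star x) = star (p.liftL φ h x)
    induction x using p.denseRange_emb.induction_on with
    | hp => exact isClosed_eq (by fun_prop) (by fun_prop)
    | ih x => rw [← emb_star, liftL_emb, liftL_emb, hstar]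

section

variable {C : Type*} [NonUnitalCStarAlgebra C] (φ : R →ₗ[ℂ] C) (h : ∀ x, ‖φ x‖ = p x)
  (hmul : ∀ x y, φ (x * y) = φ x * φ y) (hstar : ∀ x, φ (star x) = star (φ x))

lemma lift_emb (x : R) : p.lift φ h hmul hstar (p.emb x) = φ x := p.liftL_emb φ h x

lemma isometry_lift : Isometry (p.lift φ h hmul hstar) :=
  AddMonoidHomClass.isometry_of_norm _ (p.norm_liftL φ h)

end

end Construct

end CStarNorm

/-! ### The actions on a Hilbert module from the left and from the right -/

section Actions

variable {A E : Type*} [NonUnitalCStarAlgebra A] [PartialOrder A] [StarOrderedRing A]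
  [SMul A E] [NormedAddCommGroup E] [NormedSpace ℂ E] [CStarModule A E]

variable (A E) in
/-- The action of `𝓛(E)` on `E`. -/
def leftAct : Adjointable A E →ₗ[ℂ] E →ₗ[ℂ] E where
  toFun S := S.toCLM
  map_add' _ _ := rfl
  map_smul' _ _ := rfl

lemma leftAct_apply (S : Adjointable A E) (x : E) : leftAct A E S x = S.toCLM x := rfl

lemma leftAct_injective : Function.Injective (leftAct A E) := fun _ _ h =>
  Adjointable.ext' fun x => LinearMap.congr_fun h x

lemma leftAct_mul (S T : Adjointable A E) (x : E) :
    leftAct A E (S * T) x = leftAct A E S (leftAct A E T x) := rfl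

lemma leftAct_one (x : E) : leftAct A E 1 x = x := rfl

lemma ternary_leftAct (S : Adjointable A E) (x y z : E) :
    ternary A E x (leftAct A E S y) z = ternary A E x y (leftAct A E (star S) z) := by
  rw [ternary_apply, ternary_apply, leftAct_apply, leftAct_apply, Adjointable.inner_star_right]

end Actions

section RightAction

variable {B E : Type*} [NonUnitalCStarAlgebra B] [PartialOrder B] [StarOrderedRing B]
  [NormedAddCommGroup E] [NormedSpace ℂ E] [SMul Bᵐᵒᵖ E] [CStarModule Bᵐᵒᵖ E]

variable (B E) in
/-- The right action of `B` on a right Hilbert `B`-module. -/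
def rightAct : B →ₗ[ℂ] E →ₗ[ℂ] E where
  toFun b :=
    { toFun := fun x => MulOpposite.op b • x
      map_add' := op_smul_add Bᵐᵒᵖ _
      map_smul' := op_smul_smul Bᵐᵒᵖ _ }
  map_add' b c := LinearMap.ext fun x => add_op_smul Bᵐᵒᵖ (MulOpposite.op b) (MulOpposite.op c) x
  map_smul' c b := LinearMap.ext fun x => smul_op_smul Bᵐᵒᵖ c (MulOpposite.op b) x

lemma rightAct_apply (b : B) (x : E) : rightAct B E b x = MulOpposite.op b • x := rfl

lemma rightAct_mul (b c : B) (x : E) :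
    rightAct B E (b * c) x = rightAct B E c (rightAct B E b x) :=
  mul_op_smul Bᵐᵒᵖ (MulOpposite.op c) (MulOpposite.op b) x

lemma ternary_rightAct (b : B) (x y z : E) :
    ternary Bᵐᵒᵖ E x (rightAct B E b y) z = ternary Bᵐᵒᵖ E (rightAct B E (star b) x) y z := by
  simp only [ternary_apply, rightAct_apply, CStarModule.inner_op_smul_left, mul_op_smul,
    MulOpposite.op_star]

/-- The only place where fullness is used. If `b` annihilates `E`, it annihilates all inner
products, hence by density the whole coefficient algebra, and in particular `b* b = 0`. -/
lemma rightAct_injective (hE : IsFull Bᵐᵒᵖ E) : Function.Injective (rightAct B E) := by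
  rw [injective_iff_map_eq_zero]
  intro b hb
  have h : ∀ a : Bᵐᵒᵖ, MulOpposite.op b * a = 0 := by
    intro a
    induction a using hE.induction with
    | mem a ha =>
      induction ha using Submodule.span_induction with
      | mem a h =>
        obtain ⟨x, y, rfl⟩ := h
        rw [← CStarModule.inner_op_smul_right, ← rightAct_apply, hb, LinearMap.zero_apply,
          CStarModule.inner_zero_right]
      | zero => rw [mul_zero]
      | add _ _ _ _ h h' => rw [mul_add, h, h', add_zero]
      | smul c _ _ h => rw [mul_smul_comm, h, smul_zero]
    | isClosed => exact isClosed_eq (by fun_prop) (by fun_prop)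
  have h' := h (star (MulOpposite.op b))
  rw [CStarRing.mul_star_self_eq_zero_iff] at h'
  exact MulOpposite.op_injective h'

variable (B E) in
/-- The right action of the unitization of `B` on a right Hilbert `B`-module. -/
def rightActUnitization : Unitization ℂ B →ₗ[ℂ] E →ₗ[ℂ] E where
  toFun u := u.fst • LinearMap.id + rightAct B E u.snd
  map_add' u v := by
    rw [Unitization.fst_add, Unitization.snd_add, map_add, add_smul]; abel
  map_smul' c u := by
    rw [Unitization.fst_smul, Unitization.snd_smul, map_smul, smul_add, smul_assoc]; rfl

lemma rightActUnitization_apply (u : Unitization ℂ B) (x : E) :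
    rightActUnitization B E u x = u.fst • x + rightAct B E u.snd x := rfl

lemma rightActUnitization_inr (b : B) : rightActUnitization B E b = rightAct B E b := by
  ext x; simp [rightActUnitization_apply]

lemma rightActUnitization_one (x : E) : rightActUnitization B E 1 x = x := by
  simp [rightActUnitization_apply]

lemma rightActUnitization_mul (u v : Unitization ℂ B) (x : E) :
    rightActUnitization B E (u * v) x =
      rightActUnitization B E v (rightActUnitization B E u x) := by
  simp only [rightActUnitization_apply, Unitization.fst_mul, Unitization.snd_mul, map_add,
    map_smul, LinearMap.add_apply, LinearMap.smul_apply, rightAct_mul, smul_add, smul_smul]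
  abel

lemma ternary_rightActUnitization (u : Unitization ℂ B) (x y z : E) :
    ternary Bᵐᵒᵖ E x (rightActUnitization B E u y) z =
      ternary Bᵐᵒᵖ E (rightActUnitization B E (star u) x) y z := by
  simp only [rightActUnitization_apply, map_add, LinearMap.add_apply, ternary_rightAct, map_smul,
    map_smulₛₗ, LinearMap.smul_apply, Unitization.fst_star, Unitization.snd_star]
  rfl

variable (B E) in
/-- The `B`-valued inner product of a right Hilbert module, as a sesquilinear map. -/
def rightInner : E →ₗ⋆[ℂ] E →ₗ[ℂ] B :=
  (CStarModule.innerₛₗ : E →ₗ⋆[ℂ] E →ₗ[ℂ] Bᵐᵒᵖ).compr₂ₛₗ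
    (MulOpposite.opLinearEquiv ℂ).symm.toLinearMap

lemma rightInner_apply (x y : E) : rightInner B E x y = (inner Bᵐᵒᵖ x y).unop := rfl

lemma star_rightInner (x y : E) : star (rightInner B E x y) = rightInner B E y x := by
  rw [rightInner_apply, ← MulOpposite.unop_star, CStarModule.star_inner, rightInner_apply]

lemma rightInner_rightAct (b : B) (x y : E) :
    rightInner B E x (rightAct B E b y) = rightInner B E x y * b := by
  rw [rightInner_apply, rightAct_apply, CStarModule.inner_op_smul_right]; rfl

lemma rightInner_leftAct (S : Adjointable Bᵐᵒᵖ E) (x y : E) :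
    rightInner B E (leftAct Bᵐᵒᵖ E S x) y = rightInner B E x (leftAct Bᵐᵒᵖ E (star S) y) := by
  rw [rightInner_apply, rightInner_apply, leftAct_apply, leftAct_apply,
    Adjointable.inner_star_right]

lemma rightInner_theta (x y z : E) :
    rightInner B E x (leftAct Bᵐᵒᵖ E (theta Bᵐᵒᵖ y y) z) =
      star (rightInner B E y x) * rightInner B E y z := by
  rw [leftAct_apply, theta_apply, rightInner_apply, CStarModule.inner_op_smul_right,
    star_rightInner]; rfl

end RightAction

/-! ### Operators on the tensor product of two Hilbert modules -/

section TensorTernary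

variable {A B E F : Type*}
  [NonUnitalCStarAlgebra A] [PartialOrder A] [StarOrderedRing A]
  [NonUnitalCStarAlgebra B] [PartialOrder B] [StarOrderedRing B]
  [SMul A E] [NormedAddCommGroup E] [NormedSpace ℂ E] [CStarModule A E]
  [SMul B F] [NormedAddCommGroup F] [NormedSpace ℂ F] [CStarModule B F]

local notation "μ" => tensorTernary A B E F

@[simp] lemma tensorTernary_zero_left (y z : E ⊗[ℂ] F) : μ 0 y z = 0 := by simp [tensorTernary]
@[simp] lemma tensorTernary_zero_mid (x z : E ⊗[ℂ] F) : μ x 0 z = 0 := by simp [tensorTernary]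
@[simp] lemma tensorTernary_zero_right (x y : E ⊗[ℂ] F) : μ x y 0 = 0 := by simp [tensorTernary]
lemma tensorTernary_add_left (x x' y z : E ⊗[ℂ] F) : μ (x + x') y z = μ x y z + μ x' y z := by
  simp [tensorTernary]
lemma tensorTernary_add_mid (x y y' z : E ⊗[ℂ] F) : μ x (y + y') z = μ x y z + μ x y' z := by
  simp [tensorTernary]
lemma tensorTernary_add_right (x y z z' : E ⊗[ℂ] F) : μ x y (z + z') = μ x y z + μ x y z' := by
  simp [tensorTernary]

/-- Induction on three elements of `E ⊙ F`. -/
lemma tensor_induction₃ {p : E ⊗[ℂ] F → E ⊗[ℂ] F → E ⊗[ℂ] F → Prop}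
    (zl : ∀ y z, p 0 y z) (zm : ∀ x z, p x 0 z) (zr : ∀ x y, p x y 0)
    (al : ∀ x x' y z, p x y z → p x' y z → p (x + x') y z)
    (am : ∀ x y y' z, p x y z → p x y' z → p x (y + y') z)
    (ar : ∀ x y z z', p x y z → p x y z' → p x y (z + z'))
    (t : ∀ e f e' f' e'' f'', p (e ⊗ₜ f) (e' ⊗ₜ f') (e'' ⊗ₜ f'')) (x y z : E ⊗[ℂ] F) :
    p x y z := by
  induction x with
  | zero => exact zl _ _
  | add _ _ h h' => exact al _ _ _ _ h h'
  | tmul e f =>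
    induction y with
    | zero => exact zm _ _
    | add _ _ h h' => exact am _ _ _ _ h h'
    | tmul e' f' =>
      induction z with
      | zero => exact zr _ _
      | add _ _ h h' => exact ar _ _ _ _ h h'
      | tmul e'' f'' => exact t _ _ _ _ _ _

section

variable {R S : Type*} [NonUnitalRing R] [StarRing R] [Module ℂ R] [StarModule ℂ R]
  [IsScalarTower ℂ R R] [SMulCommClass ℂ R R]
  [NonUnitalRing S] [StarRing S] [Module ℂ S] [StarModule ℂ S]
  [IsScalarTower ℂ S S] [SMulCommClass ℂ S S]
  {f : R →ₗ[ℂ] E →ₗ[ℂ] E} {g : S →ₗ[ℂ] F →ₗ[ℂ] F}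

lemma tensorOp_mul (hf : ∀ a b x, f (a * b) x = f a (f b x)) (hg : ∀ a b x, g (a * b) x = g a (g b x))
    (s t : R ⊗[ℂ] S) (x : E ⊗[ℂ] F) :
    tensorOp f g (s * t) x = tensorOp f g s (tensorOp f g t x) := by
  induction s with
  | zero => simp
  | add _ _ h h' => simp [add_mul, h, h']
  | tmul a b =>
    induction t with
    | zero => simp
    | add _ _ h h' => simp [mul_add, h, h']
    | tmul a' b' =>
      induction x with
      | zero => simp
      | add _ _ h h' => simp only [map_add, h, h']
      | tmul e f => simp [tensorOp_tmul, hf, hg]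

lemma tensorOp_mul_rev (hf : ∀ a b x, f (a * b) x = f b (f a x))
    (hg : ∀ a b x, g (a * b) x = g b (g a x)) (s t : R ⊗[ℂ] S) (x : E ⊗[ℂ] F) :
    tensorOp f g (s * t) x = tensorOp f g t (tensorOp f g s x) := by
  induction s with
  | zero => simp
  | add _ _ h h' => simp [add_mul, h, h']
  | tmul a b =>
    induction t with
    | zero => simp
    | add _ _ h h' => simp [mul_add, h, h']
    | tmul a' b' =>
      induction x with
      | zero => simp
      | add _ _ h h' => simp only [map_add, h, h']
      | tmul e f => simp [tensorOp_tmul, hf, hg]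

lemma tensorTernary_tensorOp_left
    (hf : ∀ a x y z, ternary A E x (f a y) z = ternary A E x y (f (star a) z))
    (hg : ∀ a x y z, ternary B F x (g a y) z = ternary B F x y (g (star a) z))
    (t : R ⊗[ℂ] S) (x y z : E ⊗[ℂ] F) :
    μ x (tensorOp f g t y) z = μ x y (tensorOp f g (star t) z) := by
  induction t with
  | zero => simp
  | add _ _ h h' => simp [tensorTernary_add_mid, tensorTernary_add_right, h, h']
  | tmul a b =>
    induction x, y, z using tensor_induction₃ with
    | zl | zm | zr => simp
    | al _ _ _ _ h h' => simp only [tensorTernary_add_left, h, h']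
    | am _ _ _ _ h h' => simp only [map_add, tensorTernary_add_mid, h, h']
    | ar _ _ _ _ h h' => simp only [map_add, tensorTernary_add_right, h, h']
    | t => simp only [TensorProduct.star_tmul, tensorOp_tmul, tensorTernary_tmul, hf, hg]

lemma tensorTernary_tensorOp_right
    (hf : ∀ a x y z, ternary A E x (f a y) z = ternary A E (f (star a) x) y z)
    (hg : ∀ a x y z, ternary B F x (g a y) z = ternary B F (g (star a) x) y z)
    (t : R ⊗[ℂ] S) (x y z : E ⊗[ℂ] F) :
    μ x (tensorOp f g t y) z = μ (tensorOp f g (star t) x) y z := by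
  induction t with
  | zero => simp
  | add _ _ h h' => simp [tensorTernary_add_mid, tensorTernary_add_left, h, h']
  | tmul a b =>
    induction x, y, z using tensor_induction₃ with
    | zl | zm | zr => simp
    | al _ _ _ _ h h' => simp only [map_add, tensorTernary_add_left, h, h']
    | am _ _ _ _ h h' => simp only [map_add, tensorTernary_add_mid, h, h']
    | ar _ _ _ _ h h' => simp only [tensorTernary_add_right, h, h']
    | t => simp only [TensorProduct.star_tmul, tensorOp_tmul, tensorTernary_tmul, hf, hg]

end

end TensorTernary

/-! ### Approximation of the identity by positive operators of finite rank -/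

section Approximation

variable {A E : Type*} [NonUnitalCStarAlgebra A] [PartialOrder A] [StarOrderedRing A]
  [SMul A E] [NormedAddCommGroup E] [NormedSpace ℂ E] [CStarModule A E]

/-- Conjugating a sum of `θ_{e, e}` by an operator only changes the vectors, so functions of such a
sum can be absorbed into them. -/
lemma theta_toCLM (S T : Adjointable A E) (x y : E) :
    theta A (S.toCLM x) (T.toCLM y) = S * theta A x y * star T := by
  rw [mul_theta, ← star_star (theta A (S.toCLM x) y * star T), star_mul, star_star, star_theta,
    mul_theta, star_theta]

lemma inner_theta_self (e x : E) :
    inner A x ((theta A e e).toCLM x) = star (inner A x e) * inner A x e := by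
  rw [theta_apply, CStarModule.inner_op_smul_right, CStarModule.star_inner]

lemma norm_theta_le (x y : E) : ‖theta A x y‖ ≤ ‖x‖ * ‖y‖ :=
  LinearMap.mkContinuous_norm_le _ (by positivity) fun z => by
    rw [ternary_apply]
    calc _ ≤ ‖inner A y z‖ * ‖x‖ := norm_op_smul_le A _ _
      _ ≤ (‖y‖ * ‖z‖) * ‖x‖ := by gcongr; exact CStarModule.norm_inner_le E
      _ = _ := by ring

variable [CompleteSpace E]

namespace Adjointable

/-- The order of the C⋆-algebra `𝓛(E)`. -/
instance : PartialOrder (Adjointable A E) := CStarAlgebra.spectralOrder _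

instance : StarOrderedRing (Adjointable A E) := CStarAlgebra.spectralOrderedRing _

/-- With `N = T⁻` one has `N T N = -N³`, and `N³ = M* M` is positive. So `⟨Nx, T N x⟩ = -⟨Mx, Mx⟩`
is both nonnegative and nonpositive, which forces `M = 0`, then `N³ = 0` and `N = 0`. -/
lemma nonneg_of_inner_nonneg {T : Adjointable A E} (hT : IsSelfAdjoint T)
    (h : ∀ x, 0 ≤ inner A x (T.toCLM x)) : 0 ≤ T := by
  set N := T⁻ with hN
  have hN0 : 0 ≤ N := CFC.negPart_nonneg T
  have hNs : star N = N := hN0.isSelfAdjoint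
  have hTN : N * T * N = -(N * N * N) := by
    have : T = T⁺ - T⁻ := (CFC.posPart_sub_negPart T hT).symm
    rw [this, mul_sub, CFC.negPart_mul_posPart, zero_sub, neg_mul]
  have hN3 : 0 ≤ N * N * N := by
    have := star_left_conjugate_nonneg hN0 N
    rwa [hNs] at this
  obtain ⟨M, hM⟩ := CStarAlgebra.nonneg_iff_eq_star_mul_self.1 hN3
  have hM0 : M = 0 := by
    refine ext' fun x => ?_
    have h1 := h (N.toCLM x)
    rw [← inner_star_right, hNs] at h1
    change 0 ≤ inner A x ((N * (T * N)).toCLM x) at h1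
    rw [← mul_assoc, hTN, hM] at h1
    change 0 ≤ inner A x (-((star M).toCLM (M.toCLM x))) at h1
    rw [CStarModule.inner_neg_right, inner_star_right, Left.nonneg_neg_iff] at h1
    exact CStarModule.inner_self.1 (le_antisymm h1 CStarModule.inner_self_nonneg)
  rw [hM0, mul_zero] at hM
  -- A self-adjoint element with vanishing cube is zero: the C⋆-identity is applied first to `N²`,
  -- then to `N`.
  have hN2 : star (N * N) * (N * N) = 0 := by
    rw [star_mul, hNs, ← mul_assoc, hM, zero_mul]
  rw [CStarRing.star_mul_self_eq_zero_iff] at hN2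
  rw [← hNs, mul_assoc] at hM
  have hN1 : star N * N = 0 := by rw [hNs, hN2]
  rw [CStarRing.star_mul_self_eq_zero_iff] at hN1
  rw [← CFC.posPart_sub_negPart T hT, ← hN, hN1, sub_zero]
  exact CFC.posPart_nonneg T

/-- Take `c = (T + δ)^(-1/2)`. Then `1 - c T c = δ (T + δ)⁻¹`, and the product is the function `δ² t
/ (t + δ)²` of `T`. -/
lemma exists_mul_mul_approx {T : Adjointable A E} (hT : 0 ≤ T) {δ : ℝ} (hδ : 0 < δ) :
    ∃ c : Adjointable A E, star c = c ∧ ‖(1 - c * T * c) * T * (1 - c * T * c)‖ ≤ δ := by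
  have hTs : IsSelfAdjoint T := hT.isSelfAdjoint
  obtain ⟨f, hf, hff⟩ : ∃ f : ℝ → ℝ, Continuous f ∧ ∀ t, 0 ≤ t → f t * t * f t = t / (t + δ) := by
    have hpos : ∀ t : ℝ, 0 < max t 0 + δ := fun t => by positivity
    -- The truncation `max t 0` makes the function continuous on all of `ℝ`; the spectrum of `T`
    -- only sees `t ≥ 0`.
    refine ⟨fun t => (√(max t 0 + δ))⁻¹,
      Continuous.inv₀ (by fun_prop) fun t => (Real.sqrt_pos.2 (hpos t)).ne', fun t ht => ?_⟩
    simp only [max_eq_left ht]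
    rw [mul_comm, ← mul_assoc, ← mul_inv, Real.mul_self_sqrt (by positivity), mul_comm,
      div_eq_mul_inv]
  have hk : cfc f T * T * cfc f T = cfc (fun t => f t * t * f t) T := by
    rw [cfc_mul (fun t => f t * t) f T, cfc_mul f (fun t => t) T, cfc_id' ℝ T]
  have h1k : 1 - cfc f T * T * cfc f T = cfc (fun t => 1 - f t * t * f t) T := by
    rw [hk, cfc_sub (fun _ => 1) (fun t => f t * t * f t) T, cfc_const_one ℝ T]
  refine ⟨cfc f T, cfc_predicate f T, ?_⟩
  have h : (1 - cfc f T * T * cfc f T) * T * (1 - cfc f T * T * cfc f T) =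
      cfc (fun t => (1 - f t * t * f t) * t * (1 - f t * t * f t)) T := by
    rw [h1k, cfc_mul (fun t => (1 - f t * t * f t) * t) (fun t => 1 - f t * t * f t) T,
      cfc_mul (fun t => 1 - f t * t * f t) (fun t => t) T, cfc_id' ℝ T]
  rw [h]
  refine norm_cfc_le hδ.le fun t ht => ?_
  have ht0 : 0 ≤ t := spectrum_nonneg_of_nonneg hT ht
  have h1 : 1 - t / (t + δ) = δ / (t + δ) := by field_simp; ring
  rw [hff t ht0, h1, Real.norm_of_nonneg (by positivity), div_mul_eq_mul_div, div_mul_div_comm,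
    div_le_iff₀ (by positivity)]
  -- After clearing denominators the bound is `δ² t ≤ δ (t + δ)²`.
  nlinarith [mul_nonneg hδ.le (mul_nonneg ht0 ht0), mul_nonneg hδ.le (mul_nonneg ht0 hδ.le),
    mul_pos hδ (mul_pos hδ hδ)]

end Adjointable

open Adjointable

lemma theta_self_nonneg (e : E) : 0 ≤ theta A e e :=
  nonneg_of_inner_nonneg (star_theta e e) fun x => by
    rw [inner_theta_self]; exact star_mul_self_nonneg _

/-- A positive summand is dominated in norm by the sum, and testing `θ_{g, g}` on `g` itself shows
that its norm is at least `‖g‖²`. -/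
lemma norm_sq_le_norm_sum_theta {ι : Type*} (s : Finset ι) (g : ι → E) {j : ι} (hj : j ∈ s) :
    ‖g j‖ ^ 2 ≤ ‖∑ i ∈ s, theta A (g i) (g i)‖ := by
  have hle : theta A (g j) (g j) ≤ ∑ i ∈ s, theta A (g i) (g i) :=
    Finset.single_le_sum (f := fun i => theta A (g i) (g i))
      (fun i _ => theta_self_nonneg (g i)) hj
  refine le_trans ?_ (CStarAlgebra.norm_le_norm_of_nonneg_of_le (theta_self_nonneg _) hle)
  have h : ‖g j‖ ^ 2 * ‖g j‖ ^ 2 ≤ ‖theta A (g j) (g j)‖ * ‖g j‖ ^ 2 := by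
    calc ‖g j‖ ^ 2 * ‖g j‖ ^ 2 = ‖inner A (g j) ((theta A (g j) (g j)).toCLM (g j))‖ := by
          rw [inner_theta_self, CStarRing.norm_star_mul_self, CStarModule.norm_sq_eq A]
      _ ≤ ‖g j‖ * ‖(theta A (g j) (g j)).toCLM (g j)‖ := CStarModule.norm_inner_le E
      _ ≤ ‖g j‖ * (‖theta A (g j) (g j)‖ * ‖g j‖) := by gcongr; exact norm_apply_le _ _
      _ = _ := by ring
  rcases (sq_nonneg ‖g j‖).eq_or_lt with h0 | h0
  · rw [← h0]; positivity
  · exact le_of_mul_le_mul_right h h0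

variable (A) in
/-- Finitely many vectors are almost fixed by some operator `∑ θ_{u, u}`. -/
lemma exists_sum_theta_approx {ι : Type*} (s : Finset ι) (e : ι → E) {ε : ℝ} (hε : 0 < ε) :
    ∃ u : ι → E, ∀ i ∈ s, ‖(∑ k ∈ s, theta A (u k) (u k)).toCLM (e i) - e i‖ ≤ ε := by
  set T := ∑ i ∈ s, theta A (e i) (e i) with hT
  have hT0 : 0 ≤ T := Finset.sum_nonneg fun i _ => theta_self_nonneg (e i)
  -- Put `k = c T c`, which equals `∑ θ_{u, u}` for the vectors `u = c e`. Since `(1 - k) T (1 - k)`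
  -- is the sum of the `θ_{g, g}` with `g = (1 - k) e`, its norm bounds each `‖e - k e‖²`; hence the
  -- choice `δ = ε²`.
  obtain ⟨c, hc, hcT⟩ := exists_mul_mul_approx hT0 (sq_pos_of_pos hε)
  refine ⟨fun k => c.toCLM (e k), fun i hi => ?_⟩
  have hsum : ∑ k ∈ s, theta A (c.toCLM (e k)) (c.toCLM (e k)) = c * T * c := by
    simp only [theta_toCLM, hT, Finset.mul_sum, Finset.sum_mul, hc]
  have hk : star (1 - c * T * c) = 1 - c * T * c := by
    simp only [star_sub, star_one, star_mul, hc, hT0.isSelfAdjoint.star_eq, mul_assoc]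
  have h := norm_sq_le_norm_sum_theta (A := A) s (fun i => (1 - c * T * c).toCLM (e i)) hi
  simp only [theta_toCLM, ← Finset.mul_sum, ← Finset.sum_mul, hk] at h
  rw [hsum, norm_sub_rev]
  exact le_of_sq_le_sq (h.trans hcT) hε.le

end Approximation

/-! ### Bounded operators on the tensor product of two Hilbert modules -/

namespace TernaryCStarNorm

section Bounded

variable {A B E F : Type*}
  [NonUnitalCStarAlgebra A] [PartialOrder A] [StarOrderedRing A]
  [NonUnitalCStarAlgebra B] [PartialOrder B] [StarOrderedRing B]
  [SMul A E] [NormedAddCommGroup E] [NormedSpace ℂ E] [CStarModule A E]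
  [SMul B F] [NormedAddCommGroup F] [NormedSpace ℂ F] [CStarModule B F]
  (γ : TernaryCStarNorm A B E F)

local notation "μ" => tensorTernary A B E F

/-- The canonical map from `E ⊙ F` to `E ⊗_γ F`, as a linear isometry. -/
def embₗᵢ : γ.Normed →ₗᵢ[ℂ] γ.Completion := UniformSpace.Completion.toComplₗᵢ

lemma denseRange_embₗᵢ : DenseRange γ.embₗᵢ := UniformSpace.Completion.denseRange_coe

lemma denseRange_emb : DenseRange γ.emb := γ.denseRange_embₗᵢ

lemma emb_injective : Function.Injective γ.emb := γ.embₗᵢ.injective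

lemma emb_add (x y : E ⊗[ℂ] F) : γ.emb (x + y) = γ.emb x + γ.emb y := γ.embₗᵢ.map_add x y

lemma emb_smul (c : ℂ) (x : E ⊗[ℂ] F) : γ.emb (c • x) = c • γ.emb x := γ.embₗᵢ.map_smul c x

lemma nonneg (x : E ⊗[ℂ] F) : 0 ≤ γ x := by rw [← γ.norm_emb]; exact norm_nonneg _

/-- Boundedness of an operator on `E ⊙ F` for the norm `γ`. -/
def IsBounded (T : E ⊗[ℂ] F →ₗ[ℂ] E ⊗[ℂ] F) : Prop := ∃ C, ∀ x, γ (T x) ≤ C * γ x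

variable {γ}

lemma IsBounded.zero : γ.IsBounded 0 := ⟨0, fun x => by
  rw [LinearMap.zero_apply, zero_mul]; exact γ.map_zero'.le⟩

lemma IsBounded.add {S T : E ⊗[ℂ] F →ₗ[ℂ] E ⊗[ℂ] F} (hS : γ.IsBounded S) (hT : γ.IsBounded T) :
    γ.IsBounded (S + T) := by
  obtain ⟨C, hC⟩ := hS
  obtain ⟨D, hD⟩ := hT
  refine ⟨C + D, fun x => (γ.add_le' _ _).trans ?_⟩
  rw [add_mul]
  exact add_le_add (hC x) (hD x)

lemma IsBounded.smul (c : ℂ) {T : E ⊗[ℂ] F →ₗ[ℂ] E ⊗[ℂ] F} (hT : γ.IsBounded T) :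
    γ.IsBounded (c • T) := by
  obtain ⟨C, hC⟩ := hT
  refine ⟨‖c‖ * C, fun x => (γ.smul' _ _).le.trans ?_⟩
  rw [mul_assoc]
  exact mul_le_mul_of_nonneg_left (hC x) (norm_nonneg c)

variable (γ)

/-- The model is a unitary `T` with `T' = T*`: in `μ(Tx, Tx, Tx)` the middle `T` moves to the right
slot, where it cancels, leaving `μ(Tx, x, x)`. -/
lemma le_of_ternary_mid {T T' : E ⊗[ℂ] F →ₗ[ℂ] E ⊗[ℂ] F}
    (h : ∀ x y z, μ x (T y) z = μ x y (T' z)) (h' : ∀ x, T' (T x) = x) (x : E ⊗[ℂ] F) :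
    γ (T x) ≤ γ x := by
  have h3 : γ (T x) ^ 2 * γ (T x) ≤ γ x ^ 2 * γ (T x) := by
    calc γ (T x) ^ 2 * γ (T x) = γ (μ (T x) x x) := by
          rw [← pow_succ, ← γ.map_ternary_self', h, h']
      _ ≤ γ (T x) * γ x * γ x := γ.map_ternary_le' _ _ _
      _ = _ := by ring
  rcases (γ.nonneg (T x)).eq_or_lt with h0 | h0
  · rw [← h0]; exact γ.nonneg x
  · exact le_of_sq_le_sq (le_of_mul_le_mul_right h3 h0) (γ.nonneg x)

lemma le_of_ternary_left {T T' : E ⊗[ℂ] F →ₗ[ℂ] E ⊗[ℂ] F}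
    (h : ∀ x y z, μ x (T y) z = μ (T' x) y z) (h' : ∀ x, T' (T x) = x) (x : E ⊗[ℂ] F) :
    γ (T x) ≤ γ x := by
  have h3 : γ (T x) ^ 2 * γ (T x) ≤ γ x ^ 2 * γ (T x) := by
    calc γ (T x) ^ 2 * γ (T x) = γ (μ x x (T x)) := by
          rw [← pow_succ, ← γ.map_ternary_self', h, h']
      _ ≤ γ x * γ x * γ (T x) := γ.map_ternary_le' _ _ _
      _ = _ := by ring
  rcases (γ.nonneg (T x)).eq_or_lt with h0 | h0
  · rw [← h0]; exact γ.nonneg x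
  · exact le_of_sq_le_sq (le_of_mul_le_mul_right h3 h0) (γ.nonneg x)

/-! ### Boundedness of the actions of unital C⋆-algebras, by way of unitaries. -/

section Unital

variable {R S : Type*} [CStarAlgebra R] [CStarAlgebra S]
  {f : R →ₗ[ℂ] E →ₗ[ℂ] E} {g : S →ₗ[ℂ] F →ₗ[ℂ] F}

lemma tensorOp_one (hf : ∀ x, f 1 x = x) (hg : ∀ x, g 1 x = x) (x : E ⊗[ℂ] F) :
    tensorOp f g (1 ⊗ₜ 1) x = x := by
  induction x with
  | zero => simp
  | add _ _ h h' => simp only [map_add, h, h']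
  | tmul e f => rw [tensorOp_tmul, hf, hg]

/-- A unital C⋆-algebra is the linear span of its unitaries, and bounded operators form a linear
space. The bound depends on `t`; sharp estimates come later from the C⋆-identity. -/
lemma isBounded_of_unitary
    (h : ∀ (u : unitary R) (v : unitary S) x, γ (tensorOp f g ((u : R) ⊗ₜ (v : S)) x) ≤ γ x)
    (t : R ⊗[ℂ] S) : γ.IsBounded (tensorOp f g t) := by
  induction t with
  | zero => rw [map_zero]; exact .zero
  | add _ _ h h' => rw [map_add]; exact h.add h'
  | tmul a b =>
    have ha : a ∈ Submodule.span ℂ (unitary R : Set R) := by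
      rw [CStarAlgebra.span_unitary]; trivial
    have hb : b ∈ Submodule.span ℂ (unitary S : Set S) := by
      rw [CStarAlgebra.span_unitary]; trivial
    induction ha using Submodule.span_induction with
    | zero => rw [TensorProduct.zero_tmul, map_zero]; exact .zero
    | add _ _ _ _ h h' => rw [TensorProduct.add_tmul, map_add]; exact h.add h'
    | smul c _ _ h => rw [← TensorProduct.smul_tmul', map_smul]; exact h.smul c
    | mem u hu =>
      induction hb using Submodule.span_induction with
      | zero => rw [TensorProduct.tmul_zero, map_zero]; exact .zero
      | add _ _ _ _ h h' => rw [TensorProduct.tmul_add, map_add]; exact h.add h'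
      | smul c _ _ h => rw [TensorProduct.tmul_smul, map_smul]; exact h.smul c
      | mem v hv => exact ⟨1, fun x => by rw [one_mul]; exact h ⟨u, hu⟩ ⟨v, hv⟩ x⟩

lemma isBounded_tensorOp_left (hf1 : ∀ x, f 1 x = x) (hg1 : ∀ x, g 1 x = x)
    (hfm : ∀ a b x, f (a * b) x = f a (f b x)) (hgm : ∀ a b x, g (a * b) x = g a (g b x))
    (hf : ∀ a x y z, ternary A E x (f a y) z = ternary A E x y (f (star a) z))
    (hg : ∀ a x y z, ternary B F x (g a y) z = ternary B F x y (g (star a) z))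
    (t : R ⊗[ℂ] S) : γ.IsBounded (tensorOp f g t) := by
  refine γ.isBounded_of_unitary (fun u v => γ.le_of_ternary_mid
    (tensorTernary_tensorOp_left hf hg _) fun x => ?_) t
  rw [← tensorOp_mul hfm hgm, TensorProduct.star_tmul, Algebra.TensorProduct.tmul_mul_tmul,
    Unitary.coe_star_mul_self, Unitary.coe_star_mul_self, tensorOp_one hf1 hg1]

lemma isBounded_tensorOp_right (hf1 : ∀ x, f 1 x = x) (hg1 : ∀ x, g 1 x = x)
    (hfm : ∀ a b x, f (a * b) x = f b (f a x)) (hgm : ∀ a b x, g (a * b) x = g b (g a x))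
    (hf : ∀ a x y z, ternary A E x (f a y) z = ternary A E (f (star a) x) y z)
    (hg : ∀ a x y z, ternary B F x (g a y) z = ternary B F (g (star a) x) y z)
    (t : R ⊗[ℂ] S) : γ.IsBounded (tensorOp f g t) := by
  refine γ.isBounded_of_unitary (fun u v => γ.le_of_ternary_left
    (tensorTernary_tensorOp_right hf hg _) fun x => ?_) t
  -- The action reverses products, so the relation used is `u u* = 1` where the left action uses `u*
  -- u = 1`.
  rw [← tensorOp_mul_rev hfm hgm, TensorProduct.star_tmul, Algebra.TensorProduct.tmul_mul_tmul,
    Unitary.mul_star_self_of_mem u.2, Unitary.mul_star_self_of_mem v.2, tensorOp_one hf1 hg1]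

end Unital

/-! ### Extension of bounded operators to `E ⊗_γ F` and estimates of their norms. -/

section Extension

variable {R : Type*} [AddCommGroup R] [Module ℂ R] (π : R →ₗ[ℂ] E ⊗[ℂ] F →ₗ[ℂ] E ⊗[ℂ] F)
  (hπ : ∀ r, γ.IsBounded (π r))

/-- The extension to `E ⊗_γ F` of a bounded operator on `E ⊙ F`. -/
def extendCLM (T : E ⊗[ℂ] F →ₗ[ℂ] E ⊗[ℂ] F) (hT : γ.IsBounded T) :
    γ.Completion →L[ℂ] γ.Completion :=
  ((show γ.Normed →ₗ[ℂ] γ.Normed from T).mkContinuousOfExistsBound hT).completion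

lemma extendCLM_emb (T : E ⊗[ℂ] F →ₗ[ℂ] E ⊗[ℂ] F) (hT : γ.IsBounded T) (x : E ⊗[ℂ] F) :
    γ.extendCLM T hT (γ.emb x) = γ.emb (T x) :=
  ContinuousLinearMap.completion_apply_coe _ _

lemma clm_ext {S T : γ.Completion →L[ℂ] γ.Completion} (h : ∀ x, S (γ.emb x) = T (γ.emb x)) :
    S = T := by
  ext x
  induction x using γ.denseRange_emb.induction_on with
  | hp => exact isClosed_eq (by fun_prop) (by fun_prop)
  | ih x => exact h x

lemma opNorm_le_of_emb {T : γ.Completion →L[ℂ] γ.Completion} {C : ℝ} (hC : 0 ≤ C)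
    (h : ∀ x, ‖T (γ.emb x)‖ ≤ C * γ x) : ‖T‖ ≤ C := by
  refine T.opNorm_le_bound hC fun x => ?_
  induction x using γ.denseRange_emb.induction_on with
  | hp => exact isClosed_le (by fun_prop) (by fun_prop)
  | ih x => rw [γ.norm_emb]; exact h x

/-- The extension to `E ⊗_γ F` of a family of bounded operators on `E ⊙ F`. -/
def extendMap : R →ₗ[ℂ] γ.Completion →L[ℂ] γ.Completion where
  toFun r := γ.extendCLM (π r) (hπ r)
  map_add' r s := γ.clm_ext fun x => by
    simp [extendCLM_emb, emb_add]
  map_smul' c r := γ.clm_ext fun x => by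
    simp [extendCLM_emb, emb_smul]

lemma extendMap_emb (r : R) (x : E ⊗[ℂ] F) : γ.extendMap π hπ r (γ.emb x) = γ.emb (π r x) :=
  γ.extendCLM_emb _ _ _

lemma apply_le_norm_extendMap (r : R) (x : E ⊗[ℂ] F) :
    γ (π r x) ≤ ‖γ.extendMap π hπ r‖ * γ x := by
  rw [← γ.norm_emb, ← γ.norm_emb, ← γ.extendMap_emb π hπ]
  exact ContinuousLinearMap.le_opNorm _ _

lemma norm_extendMap_le {r : R} {C : ℝ} (hC : 0 ≤ C) (h : ∀ x, γ (π r x) ≤ C * γ x) :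
    ‖γ.extendMap π hπ r‖ ≤ C :=
  γ.opNorm_le_of_emb hC fun x => by rw [extendMap_emb, norm_emb]; exact h x

lemma extendMap_injective (h : Function.Injective π) : Function.Injective (γ.extendMap π hπ) := by
  intro r s hrs
  refine h (LinearMap.ext fun x => γ.emb_injective ?_)
  rw [← γ.extendMap_emb π hπ, ← γ.extendMap_emb π hπ, hrs]

/-- The source of the C⋆-identity, with `C` the norm of `t* t` or `t t*`. The axiom on `μ(x, x, x)`
yields estimates of cubes, so one obtains `N³ ≤ N C` and cancels `N`. -/
lemma norm_extendMap_mul_self_le {r : R} {C : ℝ} (hC : 0 ≤ C)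
    (h : ∀ x, γ (π r x) ^ 3 ≤ ‖γ.extendMap π hπ r‖ * C * γ x ^ 3) :
    ‖γ.extendMap π hπ r‖ * ‖γ.extendMap π hπ r‖ ≤ C := by
  set N := ‖γ.extendMap π hπ r‖ with hN
  have hN0 : 0 ≤ N := norm_nonneg _
  -- An operator norm bound needs a linear estimate, so the constant is the cube root of `N C`.
  have hK : ((N * C) ^ ((3 : ℝ)⁻¹)) ^ 3 = N * C := by
    rw [← Real.rpow_natCast, ← Real.rpow_mul (by positivity)]; norm_num
  have hle : N ≤ (N * C) ^ ((3 : ℝ)⁻¹) := by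
    refine γ.norm_extendMap_le π hπ (by positivity) fun x => ?_
    refine le_of_pow_le_pow_left₀ (n := 3) (by norm_num)
      (mul_nonneg (by positivity) (γ.nonneg x)) ?_
    rw [mul_pow, hK]
    exact h x
  have h3 : N ^ 3 ≤ N * C := by rw [← hK]; gcongr
  rcases hN0.eq_or_lt with h0 | h0
  · rw [← h0, zero_mul]; exact hC
  · refine le_of_mul_le_mul_left ?_ h0
    calc _ = N ^ 3 := by ring
      _ ≤ _ := h3

end Extension

end Bounded


/-! ### The norm on `𝓛(E) ⊙ 𝓛(F)` -/

section Left

variable {A B E F : Type*}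
  [NonUnitalCStarAlgebra A] [PartialOrder A] [StarOrderedRing A]
  [NonUnitalCStarAlgebra B] [PartialOrder B] [StarOrderedRing B]
  [SMul A E] [NormedAddCommGroup E] [NormedSpace ℂ E] [CStarModule A E]
  [SMul B F] [NormedAddCommGroup F] [NormedSpace ℂ F] [CStarModule B F]
  (γ : TernaryCStarNorm A B E F)

local notation "μ" => tensorTernary A B E F

variable (A B E F) in
/-- The action of `𝓛(E) ⊙ 𝓛(F)` on `E ⊙ F`. -/
def leftOp : Adjointable A E ⊗[ℂ] Adjointable B F →ₗ[ℂ] E ⊗[ℂ] F →ₗ[ℂ] E ⊗[ℂ] F :=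
  tensorOp (leftAct A E) (leftAct B F)

lemma leftOp_tmul (S : Adjointable A E) (T : Adjointable B F) (e : E) (f : F) :
    leftOp A B E F (S ⊗ₜ T) (e ⊗ₜ f) = S.toCLM e ⊗ₜ T.toCLM f := rfl

lemma leftOp_mul (s t : Adjointable A E ⊗[ℂ] Adjointable B F) (x : E ⊗[ℂ] F) :
    leftOp A B E F (s * t) x = leftOp A B E F s (leftOp A B E F t x) :=
  tensorOp_mul (R := Adjointable A E) (S := Adjointable B F) leftAct_mul leftAct_mul s t x

lemma tensorTernary_leftOp (t : Adjointable A E ⊗[ℂ] Adjointable B F) (x y z : E ⊗[ℂ] F) :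
    μ x (leftOp A B E F t y) z = μ x y (leftOp A B E F (star t) z) :=
  tensorTernary_tensorOp_left (R := Adjointable A E) (S := Adjointable B F)
    (f := leftAct A E) (g := leftAct B F) (ternary_leftAct (A := A) (E := E))
    (ternary_leftAct (A := B) (E := F)) t x y z

variable (A B E F) in
-- Vector spaces are flat.
lemma compactsIncl_injective : Function.Injective (compactsIncl A B E F) :=
  TensorProduct.map_injective_of_flat_flat _ _ Subtype.val_injective
    Subtype.val_injective

variable (A B E F) in
lemma compactsIncl_mul (s t : compacts A E ⊗[ℂ] compacts B F) :
    compactsIncl A B E F (s * t) = compactsIncl A B E F s * compactsIncl A B E F t :=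
  tensorMap_mul (R := compacts A E) (S := compacts B F) (R' := Adjointable A E)
    (S' := Adjointable B F) (f := (compacts A E).toSubmodule.subtype)
    (g := (compacts B F).toSubmodule.subtype) (fun _ _ => rfl) (fun _ _ => rfl) s t

variable (A B E F) in
lemma compactsIncl_star (t : compacts A E ⊗[ℂ] compacts B F) :
    compactsIncl A B E F (star t) = star (compactsIncl A B E F t) :=
  tensorMap_star (R := compacts A E) (S := compacts B F) (R' := Adjointable A E)
    (S' := Adjointable B F) (f := (compacts A E).toSubmodule.subtype)
    (g := (compacts B F).toSubmodule.subtype) (fun _ => rfl) (fun _ => rfl) t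

/-- The link between `γ` and the norms on the left: `[x, y]` acts through the ternary product. -/
lemma leftOp_tensorLeftInner (x y z : E ⊗[ℂ] F) :
    leftOp A B E F (compactsIncl A B E F (tensorLeftInner A B E F x y)) z = μ x y z := by
  induction x, y, z using tensor_induction₃ with
  | zl | zm | zr => simp
  | al _ _ _ _ h h' => simp only [map_add, LinearMap.add_apply, tensorTernary_add_left, h, h']
  | am _ _ _ _ h h' => simp only [map_add, LinearMap.add_apply, tensorTernary_add_mid, h, h']
  | ar _ _ _ _ h h' => simp only [map_add, tensorTernary_add_right, h, h']
  | t => rfl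

variable [CompleteSpace E] [CompleteSpace F]

/-- Completeness of `E` and `F` makes the algebras of adjointable operators unital C⋆-algebras,
which are spanned by unitaries. -/
lemma isBounded_leftOp (t : Adjointable A E ⊗[ℂ] Adjointable B F) :
    γ.IsBounded (leftOp A B E F t) :=
  γ.isBounded_tensorOp_left (R := Adjointable A E) (S := Adjointable B F)
    (f := leftAct A E) (g := leftAct B F) leftAct_one leftAct_one leftAct_mul leftAct_mul
    (ternary_leftAct (A := A) (E := E)) (ternary_leftAct (A := B) (E := F)) t

/-- The action of `𝓛(E) ⊙ 𝓛(F)` on `E ⊗_γ F`. -/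
def leftMap : Adjointable A E ⊗[ℂ] Adjointable B F →ₗ[ℂ] γ.Completion →L[ℂ] γ.Completion :=
  γ.extendMap (leftOp A B E F) γ.isBounded_leftOp

lemma leftMap_emb (t : Adjointable A E ⊗[ℂ] Adjointable B F) (x : E ⊗[ℂ] F) :
    γ.leftMap t (γ.emb x) = γ.emb (leftOp A B E F t x) := γ.extendMap_emb _ _ _ _

lemma leftMap_injective : Function.Injective γ.leftMap :=
  γ.extendMap_injective _ _ (tensorOp_injective leftAct_injective leftAct_injective)

lemma leftMap_mul (s t : Adjointable A E ⊗[ℂ] Adjointable B F) :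
    γ.leftMap (s * t) = γ.leftMap s * γ.leftMap t :=
  γ.clm_ext fun x => by
    rw [mul_apply_eq_comp, leftMap_emb, leftMap_emb, leftMap_emb, leftOp_mul]

/-- Moving the middle `t` gives `γ(tx)³ = γ(μ(tx, x, t* t x)) ≤ ‖t‖ ‖t* t‖ γ(x)³`. -/
lemma norm_leftMap_mul_self_le (t : Adjointable A E ⊗[ℂ] Adjointable B F) :
    ‖γ.leftMap t‖ * ‖γ.leftMap t‖ ≤ ‖γ.leftMap (star t * t)‖ := by
  refine γ.norm_extendMap_mul_self_le _ _ (norm_nonneg _) fun x => ?_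
  rw [← γ.map_ternary_self', tensorTernary_leftOp, ← leftOp_mul]
  refine (γ.map_ternary_le' _ _ _).trans ?_
  have h1 := γ.apply_le_norm_extendMap (leftOp A B E F) γ.isBounded_leftOp t x
  have h2 := γ.apply_le_norm_extendMap (leftOp A B E F) γ.isBounded_leftOp (star t * t) x
  have hx := γ.nonneg x
  calc _ ≤ (‖γ.leftMap t‖ * γ x) * γ x * (‖γ.leftMap (star t * t)‖ * γ x) :=
        mul_le_mul (mul_le_mul_of_nonneg_right h1 hx) h2 (γ.nonneg _) (by positivity)
    _ = ‖γ.leftMap t‖ * ‖γ.leftMap (star t * t)‖ * γ x ^ 3 := by ring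

/-- The C⋆-norm on `𝓛(E) ⊙ 𝓛(F)` given by the operator norm on `E ⊗_γ F`. -/
def leftNorm : CStarNorm (Adjointable A E ⊗[ℂ] Adjointable B F) :=
  .induced γ.leftMap γ.leftMap_injective
    (fun s t => by rw [leftMap_mul]; exact norm_mul_le _ _) γ.norm_leftMap_mul_self_le

lemma leftNorm_apply (t : Adjointable A E ⊗[ℂ] Adjointable B F) :
    γ.leftNorm t = ‖γ.leftMap t‖ := rfl

/-- The operator is `z ↦ μ(x, x, z)`: submultiplicativity bounds it from above, and its value at `z
= x` has norm `γ(x)³`. -/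
lemma leftNorm_tensorLeftInner_self (x : E ⊗[ℂ] F) :
    γ.leftNorm (compactsIncl A B E F (tensorLeftInner A B E F x x)) = γ x ^ 2 := by
  rw [leftNorm_apply]
  refine le_antisymm (γ.norm_extendMap_le _ _ (by positivity) fun z => ?_) ?_
  · rw [leftOp_tensorLeftInner, sq]; exact γ.map_ternary_le' _ _ _
  · have h := γ.apply_le_norm_extendMap (leftOp A B E F) γ.isBounded_leftOp
      (compactsIncl A B E F (tensorLeftInner A B E F x x)) x
    rw [leftOp_tensorLeftInner, γ.map_ternary_self', pow_succ] at h
    rcases (γ.nonneg x).eq_or_lt with h0 | h0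
    · rw [← h0, zero_pow two_ne_zero]; exact norm_nonneg _
    · exact le_of_mul_le_mul_right h h0

/-- The C⋆-norm on `𝓚(E) ⊙ 𝓚(F)` given by the operator norm on `E ⊗_γ F`. -/
def compactsNorm : CStarNorm (compacts A E ⊗[ℂ] compacts B F) :=
  .induced (γ.leftMap ∘ₗ compactsIncl A B E F)
    (γ.leftMap_injective.comp (compactsIncl_injective A B E F))
    (fun s t => by
      rw [LinearMap.comp_apply, compactsIncl_mul, leftMap_mul]; exact norm_mul_le _ _)
    (fun t => by
      rw [LinearMap.comp_apply, LinearMap.comp_apply, compactsIncl_mul, compactsIncl_star]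
      exact γ.norm_leftMap_mul_self_le _)

lemma leftNorm_compactsIncl (t : compacts A E ⊗[ℂ] compacts B F) :
    γ.leftNorm (compactsIncl A B E F t) = γ.compactsNorm t := rfl

/-- The map `S ↦ S ⊙ 1` into the completion of `𝓛(E) ⊙ 𝓛(F)`. -/
def tmulOne : Adjointable A E →⋆ₙₐ[ℂ] γ.leftNorm.Completion where
  toFun S := γ.leftNorm.emb (S ⊗ₜ 1)
  map_smul' c S := by rw [← TensorProduct.smul_tmul', CStarNorm.emb_smul]; rfl
  map_zero' := by rw [TensorProduct.zero_tmul, CStarNorm.emb_zero]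
  map_add' S T := by rw [TensorProduct.add_tmul, CStarNorm.emb_add]
  map_mul' S T := by
    rw [← CStarNorm.emb_mul, Algebra.TensorProduct.tmul_mul_tmul, one_mul]
  map_star' S := by rw [← CStarNorm.emb_star, TensorProduct.star_tmul, star_one]

/-- The map `T ↦ 1 ⊙ T` into the completion of `𝓛(E) ⊙ 𝓛(F)`. -/
def oneTmul : Adjointable B F →⋆ₙₐ[ℂ] γ.leftNorm.Completion where
  toFun T := γ.leftNorm.emb (1 ⊗ₜ T)
  map_smul' c T := by rw [TensorProduct.tmul_smul, CStarNorm.emb_smul]; rfl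
  map_zero' := by rw [TensorProduct.tmul_zero, CStarNorm.emb_zero]
  map_add' S T := by rw [TensorProduct.tmul_add, CStarNorm.emb_add]
  map_mul' S T := by
    rw [← CStarNorm.emb_mul, Algebra.TensorProduct.tmul_mul_tmul, one_mul]
  map_star' S := by rw [← CStarNorm.emb_star, TensorProduct.star_tmul, star_one]

/-- Factor `S ⊙ T = (S ⊙ 1)(1 ⊙ T)`; each leg is a `*`-homomorphism between C⋆-algebras and
therefore contractive. -/
lemma leftNorm_tmul_le (S : Adjointable A E) (T : Adjointable B F) :
    γ.leftNorm (S ⊗ₜ T) ≤ ‖S‖ * ‖T‖ := by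
  have h : γ.leftNorm.emb (S ⊗ₜ T) = γ.tmulOne S * γ.oneTmul T := by
    change _ = γ.leftNorm.emb (S ⊗ₜ 1) * γ.leftNorm.emb (1 ⊗ₜ T)
    rw [← CStarNorm.emb_mul, Algebra.TensorProduct.tmul_mul_tmul, one_mul, mul_one]
  rw [← CStarNorm.norm_emb, h]
  exact (norm_mul_le _ _).trans (mul_le_mul (NonUnitalStarAlgHom.norm_apply_le _ S)
    (NonUnitalStarAlgHom.norm_apply_le _ T) (norm_nonneg _) (norm_nonneg _))

/-- `γ` is automatically subcross, because `γ(e ⊙ f)²` is the norm of `θ_{e, e} ⊙ θ_{f, f}`. This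
makes `(e, f) ↦ e ⊙ f` continuous into `E ⊗_γ F`. -/
lemma apply_tmul_le (e : E) (f : F) : γ (e ⊗ₜ f) ≤ ‖e‖ * ‖f‖ := by
  refine le_of_sq_le_sq ?_ (by positivity)
  rw [← leftNorm_tensorLeftInner_self]
  calc _ ≤ ‖theta A e e‖ * ‖theta B f f‖ := γ.leftNorm_tmul_le _ _
    _ ≤ (‖e‖ * ‖e‖) * (‖f‖ * ‖f‖) := by gcongr <;> exact norm_theta_le _ _
    _ = _ := by ring

end Left

/-! ### The norm on the tensor product of the coefficient algebras -/

section Right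

variable {B₁ B₂ E F : Type*}
  [NonUnitalCStarAlgebra B₁] [PartialOrder B₁] [StarOrderedRing B₁]
  [NonUnitalCStarAlgebra B₂] [PartialOrder B₂] [StarOrderedRing B₂]
  [NormedAddCommGroup E] [NormedSpace ℂ E] [SMul B₁ᵐᵒᵖ E] [CStarModule B₁ᵐᵒᵖ E]
  [NormedAddCommGroup F] [NormedSpace ℂ F] [SMul B₂ᵐᵒᵖ F] [CStarModule B₂ᵐᵒᵖ F]

local notation "μ" => tensorTernary B₁ᵐᵒᵖ B₂ᵐᵒᵖ E F

variable (B₁ B₂ E F) in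
/-- The right action of `B₁ ⊙ B₂` on `E ⊙ F`. -/
def rightOp : B₁ ⊗[ℂ] B₂ →ₗ[ℂ] E ⊗[ℂ] F →ₗ[ℂ] E ⊗[ℂ] F :=
  tensorOp (rightAct B₁ E) (rightAct B₂ F)

lemma rightOp_tmul (b : B₁) (c : B₂) (e : E) (f : F) :
    rightOp B₁ B₂ E F (b ⊗ₜ c) (e ⊗ₜ f) = rightAct B₁ E b e ⊗ₜ rightAct B₂ F c f := rfl

lemma rightOp_mul (s t : B₁ ⊗[ℂ] B₂) (x : E ⊗[ℂ] F) :
    rightOp B₁ B₂ E F (s * t) x = rightOp B₁ B₂ E F t (rightOp B₁ B₂ E F s x) :=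
  tensorOp_mul_rev rightAct_mul rightAct_mul s t x

lemma tensorTernary_rightOp (t : B₁ ⊗[ℂ] B₂) (x y z : E ⊗[ℂ] F) :
    μ x (rightOp B₁ B₂ E F t y) z = μ (rightOp B₁ B₂ E F (star t) x) y z :=
  tensorTernary_tensorOp_right ternary_rightAct ternary_rightAct t x y z

/-- The coefficient algebras may have no unit, hence no unitaries; their unitizations do, and act on
the same space. -/
lemma rightOp_eq_unitization (t : B₁ ⊗[ℂ] B₂) :
    rightOp B₁ B₂ E F t = tensorOp (rightActUnitization B₁ E) (rightActUnitization B₂ F)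
      (TensorProduct.map (Unitization.inrHom ℂ ℂ B₁) (Unitization.inrHom ℂ ℂ B₂) t) := by
  induction t with
  | zero => simp
  | add _ _ h h' => simp only [map_add, h, h']
  | tmul b c =>
    refine TensorProduct.ext' fun e f => ?_
    rw [rightOp_tmul, TensorProduct.map_tmul, tensorOp_tmul, Unitization.inrHom_apply,
      Unitization.inrHom_apply, rightActUnitization_inr, rightActUnitization_inr]

variable (B₁ B₂ E F) in
/-- The `B₁ ⊙ B₂`-valued inner product on `E ⊙ F`. -/
def tensorRightInner : E ⊗[ℂ] F →ₗ⋆[ℂ] E ⊗[ℂ] F →ₗ[ℂ] B₁ ⊗[ℂ] B₂ :=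
  TensorProduct.map₂ (rightInner B₁ E) (rightInner B₂ F)

lemma tensorRightInner_tmul (e e' : E) (f f' : F) :
    tensorRightInner B₁ B₂ E F (e ⊗ₜ f) (e' ⊗ₜ f') =
      rightInner B₁ E e e' ⊗ₜ rightInner B₂ F f f' := rfl

lemma star_tensorRightInner (x y : E ⊗[ℂ] F) :
    star (tensorRightInner B₁ B₂ E F x y) = tensorRightInner B₁ B₂ E F y x := by
  induction x with
  | zero => simp
  | add _ _ h h' => simp only [map_add, LinearMap.add_apply, star_add, h, h']
  | tmul e f =>
    induction y with
    | zero => simp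
    | add _ _ h h' => simp only [map_add, LinearMap.add_apply, star_add, h, h']
    | tmul e' f' =>
      simp only [tensorRightInner_tmul, TensorProduct.star_tmul, star_rightInner]

lemma tensorRightInner_rightOp (b : B₁ ⊗[ℂ] B₂) (x y : E ⊗[ℂ] F) :
    tensorRightInner B₁ B₂ E F x (rightOp B₁ B₂ E F b y) =
      tensorRightInner B₁ B₂ E F x y * b := by
  induction b with
  | zero => simp
  | add _ _ h h' => simp only [map_add, LinearMap.add_apply, mul_add, h, h']
  | tmul b c =>
    induction x with
    | zero => simp
    | add _ _ h h' => simp only [map_add, LinearMap.add_apply, add_mul, h, h']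
    | tmul e f =>
      induction y with
      | zero => simp
      | add _ _ h h' => simp only [map_add, add_mul, h, h']
      | tmul e' f' =>
        simp only [tensorRightInner_tmul, rightOp_tmul, rightInner_rightAct,
          Algebra.TensorProduct.tmul_mul_tmul]

lemma tensorRightInner_leftOp (t : Adjointable B₁ᵐᵒᵖ E ⊗[ℂ] Adjointable B₂ᵐᵒᵖ F)
    (x y : E ⊗[ℂ] F) :
    tensorRightInner B₁ B₂ E F (leftOp B₁ᵐᵒᵖ B₂ᵐᵒᵖ E F t x) y =
      tensorRightInner B₁ B₂ E F x (leftOp B₁ᵐᵒᵖ B₂ᵐᵒᵖ E F (star t) y) := by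
  induction t with
  | zero => simp
  | add _ _ h h' => simp only [map_add, LinearMap.add_apply, star_add, h, h']
  | tmul S T =>
    induction x with
    | zero => simp
    | add _ _ h h' => simp only [map_add, LinearMap.add_apply, h, h']
    | tmul e f =>
      induction y with
      | zero => simp
      | add _ _ h h' => simp only [map_add, h, h']
      | tmul e' f' =>
        simp only [TensorProduct.star_tmul, leftOp_tmul, ← leftAct_apply, tensorRightInner_tmul,
          rightInner_leftAct]

/-- For `x = y` the right side is a square `b* b`, from which the positivity of the inner product is
derived. -/
lemma tensorRightInner_theta (u : E) (v : F) (x y : E ⊗[ℂ] F) :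
    tensorRightInner B₁ B₂ E F x
        (leftOp B₁ᵐᵒᵖ B₂ᵐᵒᵖ E F (theta B₁ᵐᵒᵖ u u ⊗ₜ theta B₂ᵐᵒᵖ v v) y) =
      star (tensorRightInner B₁ B₂ E F (u ⊗ₜ v) x) * tensorRightInner B₁ B₂ E F (u ⊗ₜ v) y := by
  induction x with
  | zero => simp
  | add _ _ h h' => simp only [map_add, LinearMap.add_apply, star_add, add_mul, h, h']
  | tmul e f =>
    induction y with
    | zero => simp
    | add _ _ h h' => simp only [map_add, mul_add, h, h']
    | tmul e' f' =>
      simp only [TensorProduct.star_tmul, leftOp_tmul, ← leftAct_apply, tensorRightInner_tmul,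
        rightInner_theta, Algebra.TensorProduct.tmul_mul_tmul]

lemma rightOp_tensorRightInner (x y z : E ⊗[ℂ] F) :
    rightOp B₁ B₂ E F (tensorRightInner B₁ B₂ E F y z) x = μ x y z := by
  induction x, y, z using tensor_induction₃ with
  | zl | zm | zr => simp
  | al _ _ _ _ h h' => simp only [map_add, tensorTernary_add_left, h, h']
  | am _ _ _ _ h h' => simp only [map_add, LinearMap.add_apply, tensorTernary_add_mid, h, h']
  | ar _ _ _ _ h h' => simp only [map_add, LinearMap.add_apply, tensorTernary_add_right, h, h']
  | t => rfl

variable (γ : TernaryCStarNorm B₁ᵐᵒᵖ B₂ᵐᵒᵖ E F)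

lemma isBounded_rightOp (t : B₁ ⊗[ℂ] B₂) : γ.IsBounded (rightOp B₁ B₂ E F t) := by
  rw [rightOp_eq_unitization]
  exact γ.isBounded_tensorOp_right rightActUnitization_one rightActUnitization_one
    rightActUnitization_mul rightActUnitization_mul ternary_rightActUnitization
    ternary_rightActUnitization _

/-- The right action of `B₁ ⊙ B₂` on `E ⊗_γ F`. -/
def rightMap : B₁ ⊗[ℂ] B₂ →ₗ[ℂ] γ.Completion →L[ℂ] γ.Completion :=
  γ.extendMap (rightOp B₁ B₂ E F) γ.isBounded_rightOp

lemma rightMap_emb (t : B₁ ⊗[ℂ] B₂) (x : E ⊗[ℂ] F) :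
    γ.rightMap t (γ.emb x) = γ.emb (rightOp B₁ B₂ E F t x) := γ.extendMap_emb _ _ _ _

lemma rightMap_mul (s t : B₁ ⊗[ℂ] B₂) : γ.rightMap (s * t) = γ.rightMap t * γ.rightMap s :=
  γ.clm_ext fun x => by
    rw [mul_apply_eq_comp, rightMap_emb, rightMap_emb, rightMap_emb, rightOp_mul]

lemma norm_rightMap_mul_self_le_mul_star (t : B₁ ⊗[ℂ] B₂) :
    ‖γ.rightMap t‖ * ‖γ.rightMap t‖ ≤ ‖γ.rightMap (t * star t)‖ := by
  refine γ.norm_extendMap_mul_self_le _ _ (norm_nonneg _) fun x => ?_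
  rw [← γ.map_ternary_self', tensorTernary_rightOp, ← rightOp_mul]
  refine (γ.map_ternary_le' _ _ _).trans ?_
  have h1 := γ.apply_le_norm_extendMap (rightOp B₁ B₂ E F) γ.isBounded_rightOp t x
  have h2 := γ.apply_le_norm_extendMap (rightOp B₁ B₂ E F) γ.isBounded_rightOp (t * star t) x
  have hx := γ.nonneg x
  calc _ ≤ (‖γ.rightMap (t * star t)‖ * γ x) * γ x * (‖γ.rightMap t‖ * γ x) :=
        mul_le_mul (mul_le_mul_of_nonneg_right h2 hx) h1 (γ.nonneg _) (by positivity)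
    _ = ‖γ.rightMap t‖ * ‖γ.rightMap (t * star t)‖ * γ x ^ 3 := by ring

lemma norm_rightMap_mul_le (s t : B₁ ⊗[ℂ] B₂) :
    ‖γ.rightMap (s * t)‖ ≤ ‖γ.rightMap s‖ * ‖γ.rightMap t‖ := by
  rw [rightMap_mul, mul_comm]; exact norm_mul_le _ _

/-- The right action reverses products, so the ternary computation gives the inequality for `t t*`.
Cancelling a factor there yields `‖t‖ ≤ ‖t*‖`, and the same inequality for `t*` finishes the proof.
-/
lemma norm_rightMap_mul_self_le (t : B₁ ⊗[ℂ] B₂) :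
    ‖γ.rightMap t‖ * ‖γ.rightMap t‖ ≤ ‖γ.rightMap (star t * t)‖ := by
  have hle : ‖γ.rightMap t‖ ≤ ‖γ.rightMap (star t)‖ := by
    have h := (γ.norm_rightMap_mul_self_le_mul_star t).trans (γ.norm_rightMap_mul_le _ _)
    rcases (norm_nonneg (γ.rightMap t)).eq_or_lt with h0 | h0
    · rw [← h0]; exact norm_nonneg _
    · exact le_of_mul_le_mul_left h h0
  have h := γ.norm_rightMap_mul_self_le_mul_star (star t)
  rw [star_star] at h
  exact (mul_le_mul hle hle (norm_nonneg _) (norm_nonneg _)).trans h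

variable (hE : IsFull B₁ᵐᵒᵖ E) (hF : IsFull B₂ᵐᵒᵖ F)

/-- The C⋆-norm on `B₁ ⊙ B₂` given by the norm of the right action on `E ⊗_γ F`. -/
def rightNorm : CStarNorm (B₁ ⊗[ℂ] B₂) :=
  .induced γ.rightMap (γ.extendMap_injective _ _
    (tensorOp_injective (rightAct_injective hE) (rightAct_injective hF)))
    γ.norm_rightMap_mul_le γ.norm_rightMap_mul_self_le

lemma rightNorm_apply (t : B₁ ⊗[ℂ] B₂) : γ.rightNorm hE hF t = ‖γ.rightMap t‖ := rfl

/-- A Cauchy–Schwarz inequality that needs no positivity: `⟨x, y⟩` acts as `z ↦ μ(z, x, y)`. It lets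
the inner product extend to the completion. -/
lemma rightNorm_tensorRightInner_le (x y : E ⊗[ℂ] F) :
    γ.rightNorm hE hF (tensorRightInner B₁ B₂ E F x y) ≤ γ x * γ y := by
  refine γ.norm_extendMap_le _ _ (mul_nonneg (γ.nonneg x) (γ.nonneg y)) fun z => ?_
  rw [rightOp_tensorRightInner, mul_comm, ← mul_assoc]
  exact γ.map_ternary_le' _ _ _

lemma rightNorm_tensorRightInner_self (x : E ⊗[ℂ] F) :
    γ.rightNorm hE hF (tensorRightInner B₁ B₂ E F x x) = γ x ^ 2 := by
  refine le_antisymm (by rw [sq]; exact γ.rightNorm_tensorRightInner_le hE hF x x) ?_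
  have h := γ.apply_le_norm_extendMap (rightOp B₁ B₂ E F) γ.isBounded_rightOp
    (tensorRightInner B₁ B₂ E F x x) x
  rw [rightOp_tensorRightInner, γ.map_ternary_self', pow_succ] at h
  rcases (γ.nonneg x).eq_or_lt with h0 | h0
  · rw [← h0, zero_pow two_ne_zero]; exact norm_nonneg (γ.rightMap _)
  · exact le_of_mul_le_mul_right h h0

/-! ### The Hilbert module structure on the completion -/

/-- The inner product of `E ⊙ F` with values in the completion of `B₁ ⊙ B₂`. -/
def innerL : γ.Normed →L⋆[ℂ] γ.Normed →L[ℂ] (γ.rightNorm hE hF).Completion :=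
  LinearMap.mkContinuous₂
    ((show γ.Normed →ₗ⋆[ℂ] γ.Normed →ₗ[ℂ] (γ.rightNorm hE hF).Normed from
      tensorRightInner B₁ B₂ E F).compr₂ₛₗ (γ.rightNorm hE hF).mkₗᵢ.toLinearMap) 1 fun x y => by
    rw [one_mul]
    exact ((γ.rightNorm hE hF).norm_emb _).le.trans (γ.rightNorm_tensorRightInner_le hE hF x y)

/-- The inner product of `E ⊗_γ F`. -/
def innerC : γ.Completion →L⋆[ℂ] γ.Completion →L[ℂ] (γ.rightNorm hE hF).Completion :=
  (((γ.innerL hE hF).extend γ.embₗᵢ.toContinuousLinearMap).flip.extend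
    γ.embₗᵢ.toContinuousLinearMap).flip

lemma innerC_emb (x y : E ⊗[ℂ] F) :
    γ.innerC hE hF (γ.emb x) (γ.emb y) =
      (γ.rightNorm hE hF).emb (tensorRightInner B₁ B₂ E F x y) := by
  have h1 : (γ.innerL hE hF).extend γ.embₗᵢ.toContinuousLinearMap (γ.emb x) = γ.innerL hE hF x :=
    ContinuousLinearMap.extend_eq _ (e := γ.embₗᵢ.toContinuousLinearMap) γ.denseRange_embₗᵢ
      γ.embₗᵢ.isometry.isUniformInducing x
  have h2 : ((γ.innerL hE hF).extend γ.embₗᵢ.toContinuousLinearMap).flip.extend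
      γ.embₗᵢ.toContinuousLinearMap (γ.emb y) =
      ((γ.innerL hE hF).extend γ.embₗᵢ.toContinuousLinearMap).flip y :=
    ContinuousLinearMap.extend_eq _ (e := γ.embₗᵢ.toContinuousLinearMap) γ.denseRange_embₗᵢ
      γ.embₗᵢ.isometry.isUniformInducing y
  exact (congrArg (fun T => T (γ.emb x)) h2).trans
    (congrArg (fun T : γ.Normed →L[ℂ] _ => T y) h1)

@[fun_prop]
lemma continuous_innerC {X : Type*} [TopologicalSpace X] {f g : X → γ.Completion}
    (hf : Continuous f) (hg : Continuous g) : Continuous fun x => γ.innerC hE hF (f x) (g x) :=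
  ((γ.innerC hE hF).continuous.comp hf).clm_apply hg

/-- The right action of the completion of `B₁ ⊙ B₂` on `E ⊗_γ F`. -/
def rightC : (γ.rightNorm hE hF).Completion →L[ℂ] γ.Completion →L[ℂ] γ.Completion :=
  (γ.rightNorm hE hF).liftL γ.rightMap fun t => (γ.rightNorm_apply hE hF t).symm

lemma rightC_emb (b : B₁ ⊗[ℂ] B₂) (x : E ⊗[ℂ] F) :
    γ.rightC hE hF ((γ.rightNorm hE hF).emb b) (γ.emb x) = γ.emb (rightOp B₁ B₂ E F b x) :=
  (congrArg (fun T : γ.Completion →L[ℂ] γ.Completion => T (γ.emb x))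
    ((γ.rightNorm hE hF).liftL_emb γ.rightMap (fun t => (γ.rightNorm_apply hE hF t).symm) b)).trans (γ.rightMap_emb b x)

@[fun_prop]
lemma continuous_rightC {X : Type*} [TopologicalSpace X] {f : X → (γ.rightNorm hE hF).Completion}
    {g : X → γ.Completion} (hf : Continuous f) (hg : Continuous g) :
    Continuous fun x => γ.rightC hE hF (f x) (g x) :=
  ((γ.rightC hE hF).continuous.comp hf).clm_apply hg

lemma star_innerC (x y : γ.Completion) :
    star (γ.innerC hE hF x y) = γ.innerC hE hF y x := by
  induction x, y using γ.denseRange_emb.induction_on₂ with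
  | hp => exact isClosed_eq (by fun_prop) (by fun_prop)
  | h x y => rw [innerC_emb, innerC_emb, ← CStarNorm.emb_star, star_tensorRightInner]

lemma innerC_rightC (b : (γ.rightNorm hE hF).Completion) (x y : γ.Completion) :
    γ.innerC hE hF x (γ.rightC hE hF b y) = γ.innerC hE hF x y * b := by
  induction b using (γ.rightNorm hE hF).denseRange_emb.induction_on with
  | hp => exact isClosed_eq (by fun_prop) (by fun_prop)
  | ih b =>
    induction x, y using γ.denseRange_emb.induction_on₂ with
    | hp => exact isClosed_eq (by fun_prop) (by fun_prop)
    | h x y =>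
      rw [rightC_emb, innerC_emb, innerC_emb, ← CStarNorm.emb_mul, tensorRightInner_rightOp]

lemma norm_innerC_self (x : γ.Completion) : ‖γ.innerC hE hF x x‖ = ‖x‖ ^ 2 := by
  induction x using γ.denseRange_emb.induction_on with
  | hp => exact isClosed_eq (by fun_prop) (by fun_prop)
  | ih x =>
    rw [innerC_emb, CStarNorm.norm_emb, γ.rightNorm_tensorRightInner_self hE hF, γ.norm_emb]

/-! ### Positivity of the inner product and the resulting Hilbert module. -/

variable [CompleteSpace E] [CompleteSpace F]

/-- The canonical bilinear map `E × F → E ⊗_γ F`. -/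
def tmulL : E →L[ℂ] F →L[ℂ] γ.Completion :=
  LinearMap.mkContinuous₂ ((TensorProduct.mk ℂ E F).compr₂
    (show E ⊗[ℂ] F →ₗ[ℂ] γ.Completion from γ.embₗᵢ.toLinearMap)) 1 fun e f => by
    rw [one_mul]
    exact (γ.norm_emb _).le.trans (γ.apply_tmul_le e f)

lemma tmulL_apply (e : E) (f : F) : γ.tmulL e f = γ.emb (e ⊗ₜ f) := rfl

lemma tendsto_emb_tmul {ι : Type*} {p : Filter ι} {a : ι → E} {b : ι → F} {e : E} {f : F}
    (ha : Filter.Tendsto a p (nhds e)) (hb : Filter.Tendsto b p (nhds f)) :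
    Filter.Tendsto (fun n => γ.emb (a n ⊗ₜ b n)) p (nhds (γ.emb (e ⊗ₜ f))) := by
  simp only [← tmulL_apply]
  have h : Continuous fun q : E × F => γ.tmulL q.1 q.2 := by fun_prop
  have h' := (h.tendsto (e, f)).comp (ha.prodMk_nhds hb)
  exact h'

lemma emb_sum {ι : Type*} (s : Finset ι) (a : ι → E ⊗[ℂ] F) :
    γ.emb (∑ i ∈ s, a i) = ∑ i ∈ s, γ.emb (a i) := map_sum γ.embₗᵢ _ _

/-- `⟨x, x⟩` is the limit of `⟨x, (k ⊙ l) x⟩`, where `k` and `l` are sums of operators `θ_{u, u}`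
and `θ_{v, v}` that almost fix the finitely many vectors occurring in `x`. -/
lemma emb_tensorRightInner_self_nonneg (x : E ⊗[ℂ] F) :
    0 ≤ (γ.rightNorm hE hF).emb (tensorRightInner B₁ B₂ E F x x) := by
  obtain ⟨s, hs⟩ := TensorProduct.exists_finset x
  have hpos : ∀ n : ℕ, 0 < 1 / ((n : ℝ) + 1) := fun n => Nat.one_div_pos_of_nat
  choose u hu using fun n => exists_sum_theta_approx B₁ᵐᵒᵖ s (fun i : E × F => i.1) (hpos n)
  choose v hv using fun n => exists_sum_theta_approx B₂ᵐᵒᵖ s (fun i : E × F => i.2) (hpos n)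
  let k : ℕ → Adjointable B₁ᵐᵒᵖ E := fun n => ∑ i ∈ s, theta B₁ᵐᵒᵖ (u n i) (u n i)
  let l : ℕ → Adjointable B₂ᵐᵒᵖ F := fun n => ∑ i ∈ s, theta B₂ᵐᵒᵖ (v n i) (v n i)
  have hk : ∀ i ∈ s, Filter.Tendsto (fun n => (k n).toCLM i.1) Filter.atTop (nhds i.1) :=
    fun i hi => tendsto_iff_norm_sub_tendsto_zero.2 <| squeeze_zero (fun _ => norm_nonneg _)
      (fun n => hu n i hi) tendsto_one_div_add_atTop_nhds_zero_nat
  have hl : ∀ i ∈ s, Filter.Tendsto (fun n => (l n).toCLM i.2) Filter.atTop (nhds i.2) :=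
    fun i hi => tendsto_iff_norm_sub_tendsto_zero.2 <| squeeze_zero (fun _ => norm_nonneg _)
      (fun n => hv n i hi) tendsto_one_div_add_atTop_nhds_zero_nat
  have hlim : Filter.Tendsto (fun n => γ.emb (leftOp B₁ᵐᵒᵖ B₂ᵐᵒᵖ E F (k n ⊗ₜ l n) x))
      Filter.atTop (nhds (γ.emb x)) := by
    have h1 : γ.emb x = ∑ i ∈ s, γ.emb (i.1 ⊗ₜ i.2) := by rw [← emb_sum, ← hs]
    have h2 : ∀ n, γ.emb (leftOp B₁ᵐᵒᵖ B₂ᵐᵒᵖ E F (k n ⊗ₜ l n) x) =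
        ∑ i ∈ s, γ.emb ((k n).toCLM i.1 ⊗ₜ (l n).toCLM i.2) := by
      intro n
      rw [← emb_sum, hs, map_sum]
      rfl
    rw [h1]
    simp only [h2]
    -- Convergence is checked on each elementary tensor, where both legs converge in norm.
    exact tendsto_finsetSum _ fun i hi => γ.tendsto_emb_tmul (hk i hi) (hl i hi)
  have hlim' := ((γ.innerC hE hF (γ.emb x)).continuous.tendsto _).comp hlim
  rw [innerC_emb] at hlim'
  -- The positive cone is closed, so it suffices to treat each approximant.
  refine ge_of_tendsto' hlim' fun n => ?_
  have hsum : tensorRightInner B₁ B₂ E F x (leftOp B₁ᵐᵒᵖ B₂ᵐᵒᵖ E F (k n ⊗ₜ l n) x) =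
      ∑ j ∈ s, ∑ i ∈ s, star (tensorRightInner B₁ B₂ E F (u n i ⊗ₜ v n j) x) *
        tensorRightInner B₁ B₂ E F (u n i ⊗ₜ v n j) x := by
    simp only [k, l, TensorProduct.sum_tmul, TensorProduct.tmul_sum, map_sum,
      LinearMap.sum_apply, tensorRightInner_theta]
  rw [Function.comp_apply, innerC_emb, hsum, CStarNorm.emb_sum]
  refine Finset.sum_nonneg fun i _ => ?_
  rw [CStarNorm.emb_sum]
  refine Finset.sum_nonneg fun j _ => ?_
  rw [CStarNorm.emb_mul, CStarNorm.emb_star]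
  exact star_mul_self_nonneg _

lemma innerC_self_nonneg (x : γ.Completion) : 0 ≤ γ.innerC hE hF x x := by
  induction x using γ.denseRange_emb.induction_on with
  | hp => exact isClosed_le (by fun_prop) (by fun_prop)
  | ih x => rw [innerC_emb]; exact γ.emb_tensorRightInner_self_nonneg hE hF x

/-- The right action of the completion of `B₁ ⊙ B₂` on `E ⊗_γ F`. -/
abbrev completionSMul : SMul (γ.rightNorm hE hF).Completionᵐᵒᵖ γ.Completion where
  smul b x := γ.rightC hE hF b.unop x

/-- `E ⊗_γ F` is a right Hilbert module over the completion of `B₁ ⊙ B₂`. -/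
abbrev completionCStarModule :
    letI := γ.completionSMul hE hF
    CStarModule (γ.rightNorm hE hF).Completionᵐᵒᵖ γ.Completion :=
  letI := γ.completionSMul hE hF
  { inner := fun x y => MulOpposite.op (γ.innerC hE hF x y)
    inner_add_right := fun {x y z} => by rw [map_add, MulOpposite.op_add]
    inner_self_nonneg := fun {x} => γ.innerC_self_nonneg hE hF x
    inner_self := fun {x} => by
      rw [MulOpposite.op_eq_zero_iff, ← norm_eq_zero, norm_innerC_self, sq_eq_zero_iff,
        norm_eq_zero]
    inner_op_smul_right := fun {b x y} =>
      congrArg MulOpposite.op (γ.innerC_rightC hE hF b.unop x y)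
    inner_smul_right_complex := fun {c x y} => by rw [map_smul, MulOpposite.op_smul]
    star_inner := fun x y => congrArg MulOpposite.op (γ.star_innerC hE hF x y)
    norm_eq_sqrt_norm_inner_self := fun x => by
      rw [MulOpposite.norm_op, norm_innerC_self, Real.sqrt_sq (norm_nonneg x)] }

/-- This places the operators `leftMap t` in `𝓛(E ⊗_γ F)` and identifies their adjoints. -/
lemma innerC_leftMap (t : Adjointable B₁ᵐᵒᵖ E ⊗[ℂ] Adjointable B₂ᵐᵒᵖ F) (x y : γ.Completion) :
    γ.innerC hE hF (γ.leftMap t x) y = γ.innerC hE hF x (γ.leftMap (star t) y) := by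
  induction x, y using γ.denseRange_emb.induction_on₂ with
  | hp => exact isClosed_eq (by fun_prop) (by fun_prop)
  | h x y => rw [leftMap_emb, leftMap_emb, innerC_emb, innerC_emb, tensorRightInner_leftOp]

/-- The action of `𝓛(E) ⊙ 𝓛(F)` on `E ⊗_γ F` by adjointable operators. -/
def leftAdjointable :
    letI := γ.completionSMul hE hF
    letI := γ.completionCStarModule hE hF
    Adjointable B₁ᵐᵒᵖ E ⊗[ℂ] Adjointable B₂ᵐᵒᵖ F →ₗ[ℂ]
      Adjointable (γ.rightNorm hE hF).Completionᵐᵒᵖ γ.Completion :=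
  letI := γ.completionSMul hE hF
  letI := γ.completionCStarModule hE hF
  { toFun := fun t => ⟨γ.leftMap t, γ.leftMap (star t), fun x y =>
      congrArg MulOpposite.op (γ.innerC_leftMap hE hF t x y)⟩
    map_add' := fun s t => Adjointable.toCLM_injective (γ.leftMap.map_add s t)
    map_smul' := fun c t => Adjointable.toCLM_injective (γ.leftMap.map_smul c t) }

end Right

/-! ### The embeddings of C⋆-algebras -/

section CompactsEmbedding

variable {A B E F : Type*}
  [NonUnitalCStarAlgebra A] [PartialOrder A] [StarOrderedRing A]
  [NonUnitalCStarAlgebra B] [PartialOrder B] [StarOrderedRing B]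
  [SMul A E] [NormedAddCommGroup E] [NormedSpace ℂ E] [CStarModule A E] [CompleteSpace E]
  [SMul B F] [NormedAddCommGroup F] [NormedSpace ℂ F] [CStarModule B F] [CompleteSpace F]
  (γ : TernaryCStarNorm A B E F)

/-- The inclusion `𝓚(E) ⊙ 𝓚(F) → 𝓛(E) ⊙ 𝓛(F)`, with values in the completion. -/
def compactsInclC : compacts A E ⊗[ℂ] compacts B F →ₗ[ℂ] γ.leftNorm.Completion where
  toFun t := γ.leftNorm.emb (compactsIncl A B E F t)
  map_add' s t := by rw [map_add, CStarNorm.emb_add]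
  map_smul' c t := by rw [map_smul, CStarNorm.emb_smul]; rfl

lemma norm_compactsInclC (t : compacts A E ⊗[ℂ] compacts B F) :
    ‖γ.compactsInclC t‖ = γ.compactsNorm t := γ.leftNorm.norm_emb _

lemma compactsInclC_mul (s t : compacts A E ⊗[ℂ] compacts B F) :
    γ.compactsInclC (s * t) = γ.compactsInclC s * γ.compactsInclC t := by
  change γ.leftNorm.emb _ = γ.leftNorm.emb _ * γ.leftNorm.emb _
  rw [compactsIncl_mul, CStarNorm.emb_mul]

lemma compactsInclC_star (t : compacts A E ⊗[ℂ] compacts B F) :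
    γ.compactsInclC (star t) = star (γ.compactsInclC t) := by
  change γ.leftNorm.emb _ = star (γ.leftNorm.emb _)
  rw [compactsIncl_star, CStarNorm.emb_star]

/-- The embedding of the completion of `𝓚(E) ⊙ 𝓚(F)` into that of `𝓛(E) ⊙ 𝓛(F)`. -/
def compactsEmbedding : γ.compactsNorm.Completion →⋆ₙₐ[ℂ] γ.leftNorm.Completion :=
  γ.compactsNorm.lift γ.compactsInclC γ.norm_compactsInclC γ.compactsInclC_mul
    γ.compactsInclC_star

lemma isometry_compactsEmbedding : Isometry γ.compactsEmbedding :=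
  γ.compactsNorm.isometry_lift _ _ _ _

lemma compactsEmbedding_emb (t : compacts A E ⊗[ℂ] compacts B F) :
    γ.compactsEmbedding (γ.compactsNorm.emb t) = γ.leftNorm.emb (compactsIncl A B E F t) :=
  γ.compactsNorm.lift_emb _ _ _ _ t

end CompactsEmbedding

section AdjointableEmbedding

variable {B₁ B₂ E F : Type*}
  [NonUnitalCStarAlgebra B₁] [PartialOrder B₁] [StarOrderedRing B₁]
  [NonUnitalCStarAlgebra B₂] [PartialOrder B₂] [StarOrderedRing B₂]
  [NormedAddCommGroup E] [NormedSpace ℂ E] [CompleteSpace E]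
  [SMul B₁ᵐᵒᵖ E] [CStarModule B₁ᵐᵒᵖ E]
  [NormedAddCommGroup F] [NormedSpace ℂ F] [CompleteSpace F]
  [SMul B₂ᵐᵒᵖ F] [CStarModule B₂ᵐᵒᵖ F]
  (γ : TernaryCStarNorm B₁ᵐᵒᵖ B₂ᵐᵒᵖ E F) (hE : IsFull B₁ᵐᵒᵖ E) (hF : IsFull B₂ᵐᵒᵖ F)

lemma leftAdjointable_mul (s t : Adjointable B₁ᵐᵒᵖ E ⊗[ℂ] Adjointable B₂ᵐᵒᵖ F) :
    letI := γ.completionSMul hE hF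
    letI := γ.completionCStarModule hE hF
    γ.leftAdjointable hE hF (s * t) = γ.leftAdjointable hE hF s * γ.leftAdjointable hE hF t :=
  letI := γ.completionSMul hE hF
  letI := γ.completionCStarModule hE hF
  Adjointable.toCLM_injective (γ.leftMap_mul s t)

lemma leftAdjointable_star (t : Adjointable B₁ᵐᵒᵖ E ⊗[ℂ] Adjointable B₂ᵐᵒᵖ F) :
    letI := γ.completionSMul hE hF
    letI := γ.completionCStarModule hE hF
    γ.leftAdjointable hE hF (star t) = star (γ.leftAdjointable hE hF t) :=
  letI := γ.completionSMul hE hF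
  letI := γ.completionCStarModule hE hF
  (Adjointable.star_eq_of_inner fun x y =>
    congrArg MulOpposite.op (γ.innerC_leftMap hE hF t x y)).symm

/-- The embedding of the completion of `𝓛(E) ⊙ 𝓛(F)` into `𝓛(E ⊗_γ F)`. -/
def adjointableEmbedding :
    letI := γ.completionSMul hE hF
    letI := γ.completionCStarModule hE hF
    γ.leftNorm.Completion →⋆ₙₐ[ℂ]
      Adjointable (γ.rightNorm hE hF).Completionᵐᵒᵖ γ.Completion :=
  letI := γ.completionSMul hE hF
  letI := γ.completionCStarModule hE hF
  γ.leftNorm.lift (C := Adjointable (γ.rightNorm hE hF).Completionᵐᵒᵖ γ.Completion)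
    -- Both norms are the operator norm on `E ⊗_γ F`, so the isometry condition holds by definition.
    (γ.leftAdjointable hE hF) (fun _ => rfl) (γ.leftAdjointable_mul hE hF)
    (γ.leftAdjointable_star hE hF)

lemma isometry_adjointableEmbedding :
    letI := γ.completionSMul hE hF
    letI := γ.completionCStarModule hE hF
    Isometry (γ.adjointableEmbedding hE hF) :=
  letI := γ.completionSMul hE hF
  letI := γ.completionCStarModule hE hF
  AddMonoidHomClass.isometry_of_norm (γ.adjointableEmbedding hE hF)
    (γ.leftNorm.norm_liftL (γ.leftAdjointable hE hF) fun _ => rfl)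

lemma adjointableEmbedding_emb (S : Adjointable B₁ᵐᵒᵖ E) (T : Adjointable B₂ᵐᵒᵖ F) (e : E)
    (f : F) :
    letI := γ.completionSMul hE hF
    letI := γ.completionCStarModule hE hF
    (γ.adjointableEmbedding hE hF (γ.leftNorm.emb (S ⊗ₜ T))).toCLM (γ.emb (e ⊗ₜ f)) =
      γ.emb (S.toCLM e ⊗ₜ T.toCLM f) := by
  let := γ.completionSMul hE hF
  let := γ.completionCStarModule hE hF
  exact (congrArg (fun R : Adjointable (γ.rightNorm hE hF).Completionᵐᵒᵖ γ.Completion =>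
    R.toCLM (γ.emb (e ⊗ₜ f))) (γ.leftNorm.liftL_emb (γ.leftAdjointable hE hF) (fun _ => rfl) (S ⊗ₜ T))).trans
      (γ.leftMap_emb (S ⊗ₜ T) (e ⊗ₜ f))

end AdjointableEmbedding

end TernaryCStarNorm

end HilbertTensor

end

theorem mainTheorem12
    {B_E B_F E F : Type*}
    [NonUnitalCStarAlgebra B_E] [PartialOrder B_E] [StarOrderedRing B_E]
    [NonUnitalCStarAlgebra B_F] [PartialOrder B_F] [StarOrderedRing B_F]
    [NormedAddCommGroup E] [NormedSpace ℂ E] [CompleteSpace E]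
    [SMul B_Eᵐᵒᵖ E] [CStarModule B_Eᵐᵒᵖ E]
    [NormedAddCommGroup F] [NormedSpace ℂ F] [CompleteSpace F]
    [SMul B_Fᵐᵒᵖ F] [CStarModule B_Fᵐᵒᵖ F]
    (hE : HilbertTensor.IsFull B_Eᵐᵒᵖ E) (hF : HilbertTensor.IsFull B_Fᵐᵒᵖ F)
    (γ : HilbertTensor.TernaryCStarNorm B_Eᵐᵒᵖ B_Fᵐᵒᵖ E F) :
    -- `E ⊗_γ F` is a right Hilbert module over `B_E ⊗_γ B_F`
    ∃ (γB : HilbertTensor.CStarNorm (B_E ⊗[ℂ] B_F))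
      (_ : SMul γB.Completionᵐᵒᵖ γ.Completion)
      (_ : CStarModule γB.Completionᵐᵒᵖ γ.Completion),
      (∀ (e e' : E) (f f' : F),
        inner γB.Completionᵐᵒᵖ (γ.emb (e ⊗ₜ[ℂ] f)) (γ.emb (e' ⊗ₜ[ℂ] f')) =
          MulOpposite.op (γB.emb
            ((inner B_Eᵐᵒᵖ e e').unop ⊗ₜ[ℂ] (inner B_Fᵐᵒᵖ f f').unop))) ∧
      -- the corresponding norm on `A_E ⊙ A_F`, and its extension to `𝓛(E) ⊙ 𝓛(F)`
      ∃ (γA : HilbertTensor.CStarNorm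
            (HilbertTensor.compacts B_Eᵐᵒᵖ E ⊗[ℂ] HilbertTensor.compacts B_Fᵐᵒᵖ F))
        (γhat : HilbertTensor.CStarNorm
            (HilbertTensor.Adjointable B_Eᵐᵒᵖ E ⊗[ℂ] HilbertTensor.Adjointable B_Fᵐᵒᵖ F)),
        (∀ x : E ⊗[ℂ] F,
          γA (HilbertTensor.tensorLeftInner B_Eᵐᵒᵖ B_Fᵐᵒᵖ E F x x) = γ x ^ 2) ∧
        (∀ t, γhat (HilbertTensor.compactsIncl B_Eᵐᵒᵖ B_Fᵐᵒᵖ E F t) = γA t) ∧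
        -- the two embeddings of C⋆-algebras
        ∃ (j : γA.Completion →⋆ₙₐ[ℂ] γhat.Completion)
          (i : γhat.Completion →⋆ₙₐ[ℂ]
            HilbertTensor.Adjointable γB.Completionᵐᵒᵖ γ.Completion),
          Isometry j ∧ Isometry i ∧
          (∀ t, j (γA.emb t) =
            γhat.emb (HilbertTensor.compactsIncl B_Eᵐᵒᵖ B_Fᵐᵒᵖ E F t)) ∧
          (∀ (S : HilbertTensor.Adjointable B_Eᵐᵒᵖ E)
             (T : HilbertTensor.Adjointable B_Fᵐᵒᵖ F) (e : E) (f : F),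
            (i (γhat.emb (S ⊗ₜ[ℂ] T))).toCLM (γ.emb (e ⊗ₜ[ℂ] f)) =
              γ.emb (S.toCLM e ⊗ₜ[ℂ] T.toCLM f)) := by
  refine ⟨γ.rightNorm hE hF, γ.completionSMul hE hF, γ.completionCStarModule hE hF,
    fun e e' f f' => congrArg MulOpposite.op (γ.innerC_emb hE hF (e ⊗ₜ f) (e' ⊗ₜ f')),
    γ.compactsNorm, γ.leftNorm, γ.leftNorm_tensorLeftInner_self, γ.leftNorm_compactsIncl,
    γ.compactsEmbedding, γ.adjointableEmbedding hE hF, γ.isometry_compactsEmbedding,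
    γ.isometry_adjointableEmbedding hE hF, γ.compactsEmbedding_emb,
    γ.adjointableEmbedding_emb hE hF⟩
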